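/- A planted binary plane tree is a finite rooted plane tree whose root has degree one and in which every other vertex is either a leaf or has exactly two (ordered: left and right) children. Horton--Strahler orders are assigned as follows: a leaf has order $1$; a vertex with two children of orders $i$ and $j$ has order $\max(i,j)+\delta_{ij}$; the root has the order of its only child. The order of the tree is the maximal order of its vertices. A branch of order $k$ is a maximal connected set of vertices of order $k$, and the Horton--Strahler number $N_k$ is the number of branches of order $k$. Let $R\ge 2$ and $1<\alpha<R$ be real. For an integer $K\ge 1$ let $\mathscr{T}_{K,R}$ be the set of planted binary plane trees of order $K$ with $$N_k\in\left(R^{K-k}-\alpha^{K-k},\;R^{K-k}+\alpha^{K-k}\right),\qquad k=1,\dots,K,$$ and let $\mathscr{T}_{K,R,N}$ be the set of trees in $\mathscr{T}_{K,R}$ with exactly $N$ vertices (the root included). Put $$H(z)=-z\log_2 z-(1-z)\log_2(1-z)\quad(0\log_2 0=0),\qquad \mathscr{H}_\infty(R)=1-\frac{1-H(2/R)}{2-2/R}.$$ **Theorem.** 1. For every $K\ge1$ the set $\mathscr{T}_{K,R}$ is finite and nonempty, and the Shannon entropy (in bits) of the uniform distribution on it is $\log_2|\mathscr{T}_{K,R}|$.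 The smallest number of vertices of a tree in $\mathscr{T}_{K,R}$ tends to infinity as $K\to\infty$. 2. The entropy rate is $\mathscr{H}_\infty(R)$: as $N\to\infty$ along the pairs $(K,N)$ with $K\ge1$ for which some tree in $\mathscr{T}_{K,R}$ has $N$ vertices, the entropy of the uniform distribution on $\mathscr{T}_{K,R}$, divided by $N$, converges to $\mathscr{H}_\infty(R)$, $$\lim_{N\to\infty}\frac{1}{N}\log_2|\mathscr{T}_{K,R}|=1-\frac{1-H(2/R)}{2-2/R},$$ and the same limit holds for the entropy of the uniform distribution on $\mathscr{T}_{K,R,N}$, divided by $N$. 3. $\mathscr{H}_\infty(2)=0$; on $[2,\infty)$ the function $\mathscr{H}_\infty$ attains its maximum at $R=4$, with $\mathscr{H}_\infty(4)=1$; and $\mathscr{H}_\infty(R)\to\frac12$ as $R\to\infty$. -/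

import Mathlib

open Filter Topology

namespace Horton

/-- Full binary plane trees: every vertex is either a leaf or has an ordered pair of children
(a left one and a right one). -/
inductive FullTree : Type
  | leaf : FullTree
  | node (left right : FullTree) : FullTree

namespace FullTree

/-- The vertices of a full binary plane tree: its bottom vertex, and the vertices of the left and
right subtrees. -/
inductive Vertex : FullTree → Type
  | bottom (t : FullTree) : Vertex t
  | left {l r : FullTree} (v : Vertex l) : Vertex (node l r)
  | right {l r : FullTree} (v : Vertex r) : Vertex (node l r)

/-- The Horton–Strahler order of the bottom vertex: a leaf has order `1`, and a vertex with
children of orders `i` and `j` has order `max i j + δ_{ij}`. -/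
def bottomOrder : FullTree → ℕ
  | leaf => 1
  | node l r =>
      max (bottomOrder l) (bottomOrder r) + (if bottomOrder l = bottomOrder r then 1 else 0)

/-- The Horton–Strahler order of an arbitrary vertex, computed from the part of the tree that
lies above it. -/
def Vertex.order : {t : FullTree} → Vertex t → ℕ
  | _, .bottom t => t.bottomOrder
  | _, .left v => v.order
  | _, .right v => v.order

/-- The parent of a vertex, where `none` means that the vertex is the bottom vertex of the tree
and therefore has no parent inside it. -/
def Vertex.parent : {t : FullTree} → Vertex t → Option (Vertex t)
  | _, .bottom _ => none
  | _, .left v => some ((v.parent).elim (.bottom _) .left)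
  | _, .right v => some ((v.parent).elim (.bottom _) .right)

end FullTree

/-- A planted binary plane tree: a root of degree one, joined by the stem to the bottom vertex of
a full binary plane tree `top`. -/
structure PlantedTree : Type where
  top : FullTree

namespace PlantedTree

/-- The vertices of a planted tree: `none` is the root, and `some v` is the vertex `v` of the
full binary tree on top of the stem. -/
abbrev Vertex (T : PlantedTree) : Type := Option T.top.Vertex

/-- The number `N` of vertices, the root included. -/
noncomputable def numVertices (T : PlantedTree) : ℕ := Nat.card T.Vertex

/-- The Horton–Strahler order of a vertex; the root has the order of its only child. -/
def vertexOrder (T : PlantedTree) (v : T.Vertex) : ℕ :=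
  v.elim T.top.bottomOrder FullTree.Vertex.order

/-- The underlying graph: each vertex other than the root is joined to its parent. -/
def graph (T : PlantedTree) : SimpleGraph T.Vertex :=
  SimpleGraph.fromRel fun u w => ∃ v : T.top.Vertex, u = some v ∧ w = v.parent

/-- A branch of order `k` is a maximal connected set of vertices of order `k`, that is, a
connected component of the subgraph induced on the vertices of order `k`. -/
abbrev Branch (T : PlantedTree) (k : ℕ) : Type :=
  (T.graph.induce {v | T.vertexOrder v = k}).ConnectedComponent

/-- The Horton–Strahler number `N_k`: the number of branches of order `k`. -/
noncomputable def hortonNumber (T : PlantedTree) (k : ℕ) : ℕ := Nat.card (T.Branch k)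

/-- `T` has order `K`: the maximal order of its vertices is `K`. -/
def HasOrder (T : PlantedTree) (K : ℕ) : Prop := IsGreatest (Set.range T.vertexOrder) K

end PlantedTree

/-- The space of planted binary plane trees of order `K` whose Horton–Strahler numbers satisfy
`N_k ∈ (R^(K-k) - α^(K-k), R^(K-k) + α^(K-k))` for `k = 1, …, K`. -/
def hortonSpace (K : ℕ) (R α : ℝ) : Set PlantedTree :=
  {T | T.HasOrder K ∧ ∀ k ∈ Finset.Icc 1 K,
    (T.hortonNumber k : ℝ) ∈ Set.Ioo (R ^ (K - k) - α ^ (K - k)) (R ^ (K - k) + α ^ (K - k))}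

/-- The trees of `hortonSpace K R α` with exactly `N` vertices. -/
def hortonSpaceOfSize (K : ℕ) (R α : ℝ) (N : ℕ) : Set PlantedTree :=
  {T | T ∈ hortonSpace K R α ∧ T.numVertices = N}

/-- The probability mass function of the uniform distribution on a (finite, nonempty) set. -/
noncomputable def uniformMass {X : Type*} (S : Set X) : X → ℝ :=
  S.indicator fun _ => 1 / (S.ncard : ℝ)

/-- Shannon entropy, in bits, of a probability mass function
(`0 * Real.logb 2 0 = 0` is the usual convention). -/
noncomputable def shannonEntropy {X : Type*} (P : X → ℝ) : ℝ :=
  -∑' x, P x * Real.logb 2 (P x)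

/-- The pairs `(K, N)` with `K ≥ 1` such that some tree in `hortonSpace K R α` has `N` vertices. -/
def realizablePairs (R α : ℝ) : Set (ℕ × ℕ) :=
  {p | 1 ≤ p.1 ∧ (hortonSpaceOfSize p.1 R α p.2).Nonempty}

/-- The limit `N → ∞` along the realizable pairs `(K, N)`. -/
def sizeToInfinity (R α : ℝ) : Filter (ℕ × ℕ) :=
  comap Prod.snd atTop ⊓ 𝓟 (realizablePairs R α)

/-- The binary entropy function `H(z) = -z log₂ z - (1 - z) log₂ (1 - z)`. -/
noncomputable def binaryEntropy (z : ℝ) : ℝ :=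
  -z * Real.logb 2 z - (1 - z) * Real.logb 2 (1 - z)

/-- The closed form of the entropy rate as a function of the Horton exponent. -/
noncomputable def entropyRate (R : ℝ) : ℝ := 1 - (1 - binaryEntropy (2 / R)) / (2 - 2 / R)

end Horton

/-!
Horton pruning removes the leaves of a tree, with their edges, and suppresses the vertices that
are left with a single child. It lowers all orders by one, so it sends a tree with branch numbers
`N₁, N₂, …, N_K` to one with branch numbers `N₂, …, N_K`. Conversely, a planted tree with `x` leaves
has `2 x - 1` edges, and every tree with `y` leaves that is pruned to it arises by attaching two
leaves to every leaf and distributing the other `y - 2 x` leaves along the edges, each on the left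
or on the right: there are `2 ^ (y - 2 x) * (y - 2).choose (2 x - 2)` of them
(`FullTree.card_pruneFibre`). Hence the number of trees with given branch numbers is a product of
such factors over the pairs of consecutive branch numbers (`FullTree.ncard_profileSet`).

In a Horton space, `N_k / R ^ (K - k)` tends to `1` as `K - k → ∞`, uniformly over the space. Since
`log₂ (n.choose k) = n * H (k / n) + O (1 + log n)` (`Real.abs_log_choose_sub_le`) and `H` is
continuous, also at the value `2 / R = 1`, the base-2 logarithm of the factor belonging to
`x ≈ R ^ j` and `y ≈ R ^ (j + 1)` is `(1 - 2 / R + H (2 / R) + o(1)) * R ^ (j + 1)`, uniformly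
(`tendsto_logb_extensionCount`). Summing the geometric series shows that, on the logarithmic scale,
every admissible sequence of branch numbers is realized by the same number of trees,
`2 * entropyRate R * R ^ (K - 1)` bits (`exists_abs_logb_ncard_profileSet_sub_le`), while such trees
have `2 * N₁ ≈ 2 * R ^ (K - 1)` vertices. As the number of admissible sequences is only
`exp (O (K ^ 2))`, the whole Horton space and its nonempty subsets of fixed size have this
logarithmic size as well (`exists_logb_ncard_hortonSpace_bounds`).

Branches are connected components in the statement. They are counted by the vertices whose parent
has a different order, each component having exactly one such vertex
(`SimpleGraph.card_connectedComponent_eq_card_fixedPoints`), which turns the branch numbers into the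
recursion `FullTree.branchCount`.
-/

/-! ### Components of a forest given by a parent map -/

/-- A graph whose edges join each vertex to its image under a map `q` that lowers a height
wherever it moves a vertex is a forest, and each of its components contains exactly one fixed
point of `q`. -/
theorem SimpleGraph.card_connectedComponent_eq_card_fixedPoints {V : Type*} (G : SimpleGraph V)
    (q : V → V) (d : V → ℕ) (hd : ∀ v, q v ≠ v → d (q v) < d v)
    (hadj : ∀ u w, G.Adj u w ↔ u ≠ w ∧ (q u = w ∨ q w = u)) :
    Nat.card G.ConnectedComponent = Nat.card (Function.fixedPoints q) := by
  symm
  refine Nat.card_eq_of_bijective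
    (fun f : Function.fixedPoints q => G.connectedComponentMk f.1) ⟨?_, ?_⟩
  · rintro ⟨f, hf⟩ ⟨f', hf'⟩ h
    have hr : G.Reachable f f' := SimpleGraph.ConnectedComponent.exact h
    obtain ⟨p⟩ := hr
    -- The fixed point reached by iterating `q` is constant along walks.
    have key : ∀ (u w : V), G.Walk u w → (∃ n, q^[n] u = f) → ∃ n, q^[n] w = f := by
      intro u w p
      induction p with
      | nil => exact id
      | cons h _ ih =>
        rintro ⟨n, hn⟩
        apply ih
        rcases ((hadj _ _).1 h).2 with h1 | h1
        · cases n with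
          | zero =>
            refine ⟨0, ?_⟩
            simp only [Function.iterate_zero, id] at hn ⊢
            rw [← h1, hn]; exact hf
          | succ n => exact ⟨n, by rw [← h1]; simpa using hn⟩
        · exact ⟨n + 1, by rw [Function.iterate_succ_apply, h1, hn]⟩
    obtain ⟨n, hn⟩ := key f f' p ⟨0, rfl⟩
    rw [Function.iterate_fixed hf'] at hn
    exact Subtype.ext hn.symm
  · intro c
    induction c using SimpleGraph.ConnectedComponent.ind with
    | h v =>
      induction hv : d v using Nat.strong_induction_on generalizing v with
      | _ n ih =>
        by_cases hq : q v = v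
        · exact ⟨⟨v, hq⟩, rfl⟩
        · obtain ⟨f, hf⟩ := ih _ (hv ▸ hd v hq) (q v) rfl
          refine ⟨f, hf.trans ?_⟩
          exact SimpleGraph.ConnectedComponent.sound
            ((hadj _ _).2 ⟨hq, Or.inr rfl⟩).reachable

namespace Horton

namespace FullTree

/-! ### Vertices, orders and branches of a full binary tree -/

/-- The number of leaves. -/
def leaves : FullTree → ℕ
  | leaf => 1
  | node l r => leaves l + leaves r

/-- The number of branches of order `k`, by recursion: joining two trees of equal order `i`
starts a branch of order `i + 1`, while joining trees of different orders prolongs the branch of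
the larger one. -/
def branchCount : FullTree → ℕ → ℕ
  | leaf, k => if k = 1 then 1 else 0
  | node l r, k => branchCount l k + branchCount r k +
      (if bottomOrder l = bottomOrder r ∧ k = bottomOrder l + 1 then 1 else 0)

theorem leaves_pos (t : FullTree) : 0 < t.leaves := by
  induction t <;> simp_all [leaves]

theorem bottomOrder_pos (t : FullTree) : 0 < t.bottomOrder := by
  induction t with
  | leaf => simp [bottomOrder]
  | node l r hl hr => simp only [bottomOrder]; omega

theorem bottomOrder_le_leaves (t : FullTree) : t.bottomOrder ≤ t.leaves := by
  induction t with
  | leaf => simp [bottomOrder, leaves]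
  | node l r hl hr =>
    have := l.leaves_pos
    have := r.leaves_pos
    simp only [bottomOrder, leaves]
    split_ifs <;> omega

theorem branchCount_one (t : FullTree) : t.branchCount 1 = t.leaves := by
  induction t with
  | leaf => simp [branchCount, leaves]
  | node l r hl hr =>
    have := l.bottomOrder_pos
    simp only [branchCount, leaves, hl, hr]
    rw [if_neg (by omega), add_zero]

theorem Vertex.order_le {t : FullTree} (v : t.Vertex) : v.order ≤ t.bottomOrder := by
  induction v with
  | bottom t => simp [Vertex.order]
  | left v ih => simp only [Vertex.order, bottomOrder]; omega
  | right v ih => simp only [Vertex.order, bottomOrder]; omega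

theorem Vertex.left_injective {l r : FullTree} :
    Function.Injective (Vertex.left : l.Vertex → (node l r).Vertex) := by
  intro a b h; cases h; rfl

theorem Vertex.right_injective {l r : FullTree} :
    Function.Injective (Vertex.right : r.Vertex → (node l r).Vertex) := by
  intro a b h; cases h; rfl

theorem Vertex.set_node_eq {l r : FullTree} (S : Set (node l r).Vertex) :
    S = ({v | v = .bottom _ ∧ v ∈ S} ∪ Vertex.left '' (Vertex.left ⁻¹' S)) ∪
      Vertex.right '' (Vertex.right ⁻¹' S) := by
  ext v
  constructor
  · intro hv
    cases v with
    | bottom => exact Or.inl (Or.inl ⟨rfl, hv⟩)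
    | left v => exact Or.inl (Or.inr ⟨v, hv, rfl⟩)
    | right v => exact Or.inr ⟨v, hv, rfl⟩
  · rintro ((⟨-, h⟩ | ⟨v, h, rfl⟩) | ⟨v, h, rfl⟩) <;> exact h

instance Vertex.finite (t : FullTree) : Finite t.Vertex := by
  induction t with
  | leaf =>
    refine Set.finite_univ_iff.1 ((Set.finite_singleton (Vertex.bottom leaf)).subset ?_)
    intro v _
    cases v; rfl
  | node l r hl hr =>
    refine Set.finite_univ_iff.1 ?_
    rw [Vertex.set_node_eq Set.univ]
    refine ((((Set.finite_singleton (Vertex.bottom _)).subset ?_)).union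
      (Set.toFinite _)).union (Set.toFinite _)
    rintro v ⟨h, -⟩
    exact h

open Classical in
theorem Vertex.ncard_node {l r : FullTree} (S : Set (node l r).Vertex) :
    S.ncard = (if Vertex.bottom _ ∈ S then 1 else 0) + (Vertex.left ⁻¹' S).ncard +
      (Vertex.right ⁻¹' S).ncard := by
  conv_lhs => rw [Vertex.set_node_eq S]
  rw [Set.ncard_union_eq ?_ (Set.toFinite _) (Set.toFinite _),
    Set.ncard_union_eq ?_ (Set.toFinite _) (Set.toFinite _),
    Set.ncard_image_of_injective _ left_injective, Set.ncard_image_of_injective _ right_injective]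
  · congr 2
    split_ifs with h
    · rw [Set.ncard_eq_one]
      refine ⟨.bottom _, Set.ext fun v => ⟨fun hv => hv.1, fun hv => ⟨hv, ?_⟩⟩⟩
      rw [Set.mem_singleton_iff] at hv; rwa [hv]
    · rw [Set.ncard_eq_zero]
      ext v
      simp only [Set.mem_ofPred_eq, Set.mem_empty_iff_false, iff_false, not_and]
      rintro rfl
      exact h
  · rw [Set.disjoint_left]
    rintro v ⟨rfl, -⟩ ⟨w, -, hw⟩
    cases hw
  · rw [Set.disjoint_left]
    rintro v (⟨rfl, -⟩ | ⟨u, -, rfl⟩) ⟨w, -, hw⟩ <;> cases hw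

open Classical in
theorem Vertex.ncard_leaf (S : Set leaf.Vertex) :
    S.ncard = if Vertex.bottom _ ∈ S then 1 else 0 := by
  split_ifs with h
  · rw [Set.ncard_eq_one]
    refine ⟨.bottom _, Set.ext fun v => ?_⟩
    cases v; simpa using h
  · rw [Set.ncard_eq_zero]
    ext v
    cases v; simpa using h

theorem card_vertex (t : FullTree) : Nat.card t.Vertex + 1 = 2 * t.leaves := by
  rw [← Set.ncard_univ]
  induction t with
  | leaf => rw [Vertex.ncard_leaf]; simp [leaves]
  | node l r hl hr =>
    rw [Vertex.ncard_node]
    simp only [Set.mem_univ, if_true, Set.preimage_univ, leaves]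
    omega

/-- The depth of a vertex above the root of the planted tree. -/
def Vertex.depth : {t : FullTree} → Vertex t → ℕ
  | _, .bottom _ => 1
  | _, .left v => v.depth + 1
  | _, .right v => v.depth + 1

theorem Vertex.depth_parent_lt {t : FullTree} (v : t.Vertex) :
    v.parent.elim 0 Vertex.depth < v.depth := by
  induction v with
  | bottom t => simp [parent, depth]
  | left v ih =>
    simp only [parent, Option.elim_some, depth]
    cases hv : v.parent with
    | none => simp only [Option.elim_none, depth]; rw [hv] at ih; simp at ih; omega
    | some w => rw [hv] at ih; simp only [Option.elim_some, depth] at ih ⊢; omega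
  | right v ih =>
    simp only [parent, Option.elim_some, depth]
    cases hv : v.parent with
    | none => simp only [Option.elim_none, depth]; rw [hv] at ih; simp at ih; omega
    | some w => rw [hv] at ih; simp only [Option.elim_some, depth] at ih ⊢; omega

/-- The vertices of order `k` whose parent has an order different from `k`, where the bottom
vertex is given a virtual parent of order `o`. -/
def branchBases (t : FullTree) (o k : ℕ) : Set t.Vertex :=
  {v | v.order = k ∧ v.parent.elim o Vertex.order ≠ k}

theorem ncard_branchBases (t : FullTree) (o k : ℕ) :
    (t.branchBases o k).ncard + (if t.bottomOrder = k ∧ o = k then 1 else 0) =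
      t.branchCount k := by
  classical
  induction t generalizing o with
  | leaf =>
    rw [Vertex.ncard_leaf]
    simp only [branchBases, Set.mem_ofPred_eq, Vertex.order, Vertex.parent, Option.elim_none,
      bottomOrder, branchCount]
    rcases eq_or_ne k 1 with rfl | hk
    · rcases eq_or_ne o 1 with rfl | ho
      · simp
      · simp [ho]
    · simp [hk, hk.symm]
  | node l r hl hr =>
    have h1 : (Vertex.left ⁻¹' (node l r).branchBases o k) =
        l.branchBases (node l r).bottomOrder k := by
      ext v
      simp only [branchBases, Set.mem_preimage, Set.mem_ofPred_eq, Vertex.order, Vertex.parent,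
        Option.elim_some]
      cases v.parent <;> simp [Vertex.order]
    have h2 : (Vertex.right ⁻¹' (node l r).branchBases o k) =
        r.branchBases (node l r).bottomOrder k := by
      ext v
      simp only [branchBases, Set.mem_preimage, Set.mem_ofPred_eq, Vertex.order, Vertex.parent,
        Option.elim_some]
      cases v.parent <;> simp [Vertex.order]
    have h3 : Vertex.bottom _ ∈ (node l r).branchBases o k ↔
        (node l r).bottomOrder = k ∧ o ≠ k := by
      simp [branchBases, Vertex.order, Vertex.parent]
    rw [Vertex.ncard_node, h1, h2]
    simp only [h3]
    have hl' := hl (node l r).bottomOrder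
    have hr' := hr (node l r).bottomOrder
    rw [branchCount]
    rw [← hl', ← hr']
    simp only [bottomOrder]
    split_ifs <;> omega

end FullTree

namespace PlantedTree

/-! ### Horton–Strahler numbers of a planted tree -/

theorem numVertices_eq (T : PlantedTree) : T.numVertices = 2 * T.top.leaves := by
  rw [numVertices, ← T.top.card_vertex, Finite.card_option]

theorem hasOrder_iff (T : PlantedTree) (K : ℕ) : T.HasOrder K ↔ T.top.bottomOrder = K := by
  have h : T.HasOrder T.top.bottomOrder := by
    refine ⟨⟨none, rfl⟩, ?_⟩
    rintro _ ⟨v, rfl⟩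
    cases v with
    | none => exact le_rfl
    | some v => exact v.order_le
  exact ⟨fun h' => h.unique h', fun h' => h' ▸ h⟩

/-- The parent of a vertex of a planted tree; the root is its own parent. -/
def parent (T : PlantedTree) (v : T.Vertex) : T.Vertex := v.elim none FullTree.Vertex.parent

theorem ncard_parent_order_ne (T : PlantedTree) (k : ℕ) :
    {v : T.Vertex | T.vertexOrder v = k ∧ (v = none ∨ T.vertexOrder (T.parent v) ≠ k)}.ncard =
      T.top.branchCount k := by
  classical
  have h : {v : T.Vertex | T.vertexOrder v = k ∧ (v = none ∨ T.vertexOrder (T.parent v) ≠ k)} =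
      {v : T.Vertex | v = none ∧ T.top.bottomOrder = k} ∪
        some '' T.top.branchBases T.top.bottomOrder k := by
    ext v
    cases v with
    | none => simp [vertexOrder]
    | some v => simp [vertexOrder, parent, FullTree.branchBases]
  rw [h, Set.ncard_union_eq ?_ (Set.toFinite _) (Set.toFinite _),
    Set.ncard_image_of_injective _ (Option.some_injective _), add_comm,
    ← T.top.ncard_branchBases T.top.bottomOrder k]
  · congr 1
    by_cases hk : T.top.bottomOrder = k
    · simp [hk]
    · simp [hk]
  · rw [Set.disjoint_left]
    rintro v ⟨rfl, -⟩ ⟨w, -, hw⟩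
    cases hw

theorem hortonNumber_eq (T : PlantedTree) (k : ℕ) : T.hortonNumber k = T.top.branchCount k := by
  classical
  rw [← T.ncard_parent_order_ne, hortonNumber]
  let q : {v | T.vertexOrder v = k} → {v | T.vertexOrder v = k} := fun v =>
    if h : T.vertexOrder (T.parent v.1) = k then ⟨T.parent v.1, h⟩ else v
  have hlt : ∀ v : T.Vertex, v ≠ none →
      (T.parent v).elim 0 FullTree.Vertex.depth < v.elim 0 FullTree.Vertex.depth := by
    intro v hv
    cases v with
    | none => exact absurd rfl hv
    | some v => exact v.depth_parent_lt
  have hne : ∀ v : T.Vertex, T.parent v = v → v = none := by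
    intro v hv
    by_contra h
    have := hlt v h
    rw [hv] at this
    exact lt_irrefl _ this
  have hrel : ∀ u w : T.Vertex, u ≠ w →
      ((∃ v : T.top.Vertex, u = some v ∧ w = v.parent) ↔ T.parent u = w) := by
    intro u w huw
    cases u with
    | none => simpa [parent] using huw
    | some u => simp [parent, eq_comm]
  have hq : ∀ u w : {v | T.vertexOrder v = k}, u ≠ w → (q u = w ↔ T.parent u.1 = w.1) := by
    intro u w huw
    simp only [q]
    split_ifs with h
    · rw [Subtype.ext_iff]
    · refine ⟨fun h' => absurd h' huw, fun h' => absurd ?_ h⟩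
      rw [h']; exact w.2
  rw [SimpleGraph.card_connectedComponent_eq_card_fixedPoints _ q
    (fun v => v.1.elim 0 FullTree.Vertex.depth)]
  · rw [← Nat.card_coe_set_eq]
    refine Nat.card_congr ((Equiv.subtypeSubtypeEquivSubtypeInter (T.vertexOrder · = k)
      (fun v => v = none ∨ T.vertexOrder (T.parent v) ≠ k)).symm.trans
      (Equiv.subtypeEquivRight fun v => ?_)).symm
    rw [Function.mem_fixedPoints, Function.IsFixedPt]
    simp only [q]
    split_ifs with h
    · rw [Subtype.ext_iff]
      constructor
      · rintro (h' | h')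
        · simp [h', parent]
        · exact absurd h h'
      · intro h'; exact Or.inl (hne _ h')
    · simp [h]
  · intro v hv
    have h1 : q v ≠ v := hv
    have h2 := (hq v (q v) (Ne.symm h1)).1 rfl
    rw [← h2]
    refine hlt _ fun h3 => h1 (Subtype.ext ?_)
    rw [← h2, h3]; rfl
  · intro u w
    simp only [SimpleGraph.comap_adj, Function.Embedding.subtype_apply, graph,
      SimpleGraph.fromRel_adj]
    rw [Ne, ← Subtype.ext_iff]
    refine and_congr_right fun huw => ?_
    have huw' : u.1 ≠ w.1 := fun h => huw (Subtype.ext h)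
    rw [hrel _ _ huw', hrel _ _ huw'.symm, hq _ _ huw, hq _ _ (Ne.symm huw)]

end PlantedTree
end Horton

/-! ### A convolution identity for binomial coefficients -/

/-- Vandermonde's identity for multiset coefficients. -/
theorem Nat.sum_antidiagonal_add_choose_mul (a b m : ℕ) :
    ∑ p ∈ Finset.HasAntidiagonal.antidiagonal m, (a + p.1).choose a * (b + p.2).choose b =
      (a + b + 1 + m).choose (a + b + 1) := by
  have h := congrArg (PowerSeries.coeff m)
    (pow_add (PowerSeries.mk 1 : PowerSeries ℤ) (a + 1) (b + 1))
  rw [show a + 1 + (b + 1) = (a + b + 1) + 1 by ring, PowerSeries.mk_one_pow_eq_mk_choose_add,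
    PowerSeries.mk_one_pow_eq_mk_choose_add, PowerSeries.mk_one_pow_eq_mk_choose_add,
    PowerSeries.coeff_mul] at h
  simp only [PowerSeries.coeff_mk] at h
  exact_mod_cast h.symm

namespace Horton

namespace FullTree

/-! ### Horton pruning -/

/-- Horton pruning of a tree with at least one inner vertex: the leaves are removed together with
their edges, and the resulting vertices with a single child are suppressed. The tree with a
single vertex is left unchanged. -/
def prune : FullTree → FullTree
  | leaf => leaf
  | node leaf leaf => leaf
  | node leaf (node a b) => prune (node a b)
  | node (node a b) leaf => prune (node a b)
  | node (node a b) (node c d) => node (prune (node a b)) (prune (node c d))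

theorem prune_node_leaf_right {l : FullTree} (hl : l ≠ leaf) : prune (node l leaf) = prune l := by
  cases l with
  | leaf => exact absurd rfl hl
  | node a b => rw [prune]

theorem prune_node_leaf_left {r : FullTree} (hr : r ≠ leaf) : prune (node leaf r) = prune r := by
  cases r with
  | leaf => exact absurd rfl hr
  | node a b => rw [prune]

theorem prune_node_of_ne {l r : FullTree} (hl : l ≠ leaf) (hr : r ≠ leaf) :
    prune (node l r) = node (prune l) (prune r) := by
  cases l with
  | leaf => exact absurd rfl hl
  | node a b =>
    cases r with
    | leaf => exact absurd rfl hr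
    | node c d => rw [prune]

/-- Case distinction for trees with at least one inner vertex, according to which of the two
subtrees are single leaves. -/
theorem induction_ne_leaf {P : (t : FullTree) → t ≠ leaf → Prop}
    (h0 : P (node leaf leaf) (by simp))
    (hl : ∀ r (h : r ≠ leaf), P r h → P (node leaf r) (by simp))
    (hr : ∀ l (h : l ≠ leaf), P l h → P (node l leaf) (by simp))
    (hn : ∀ l r (hl : l ≠ leaf) (hr : r ≠ leaf), P l hl → P r hr → P (node l r) (by simp))
    (t : FullTree) (ht : t ≠ leaf) : P t ht := by
  induction t with
  | leaf => exact absurd rfl ht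
  | node l r ihl ihr =>
    by_cases h1 : l = leaf
    · by_cases h2 : r = leaf
      · subst h1 h2; exact h0
      · subst h1; exact hl r h2 (ihr h2)
    · by_cases h2 : r = leaf
      · subst h2; exact hr l h1 (ihl h1)
      · exact hn l r h1 h2 (ihl h1) (ihr h2)

theorem bottomOrder_prune {t : FullTree} (ht : t ≠ leaf) :
    t.bottomOrder = t.prune.bottomOrder + 1 := by
  induction t, ht using induction_ne_leaf with
  | h0 => simp [prune, bottomOrder]
  | hl r hr ih =>
    have := r.prune.bottomOrder_pos
    rw [prune_node_leaf_left hr]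
    have h1 : leaf.bottomOrder = 1 := rfl
    rw [bottomOrder, if_neg (by omega)]; omega
  | hr l hl ih =>
    have := l.prune.bottomOrder_pos
    rw [prune_node_leaf_right hl]
    have h1 : leaf.bottomOrder = 1 := rfl
    rw [bottomOrder, if_neg (by omega)]; omega
  | hn l r hl hr ihl ihr =>
    rw [prune_node_of_ne hl hr]
    simp only [bottomOrder, ihl, ihr, Nat.add_right_cancel_iff]
    omega

theorem two_mul_leaves_prune_le {t : FullTree} (ht : t ≠ leaf) :
    2 * t.prune.leaves ≤ t.leaves := by
  induction t, ht using induction_ne_leaf with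
  | h0 => simp [prune, leaves]
  | hl r hr ih => rw [prune_node_leaf_left hr]; simp only [leaves]; omega
  | hr l hl ih => rw [prune_node_leaf_right hl]; simp only [leaves]; omega
  | hn l r hl hr ihl ihr => rw [prune_node_of_ne hl hr]; simp only [leaves]; omega

theorem branchCount_prune {t : FullTree} (ht : t ≠ leaf) {k : ℕ} (hk : 1 ≤ k) :
    t.branchCount (k + 1) = t.prune.branchCount k := by
  induction t, ht using induction_ne_leaf with
  | h0 =>
    simp only [prune, branchCount, bottomOrder]
    rcases eq_or_ne k 1 with rfl | h
    · simp
    · simp [h]; omega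
  | hl r hr ih =>
    have := r.prune.bottomOrder_pos
    have := bottomOrder_prune hr
    rw [prune_node_leaf_left hr]
    have h1 : leaf.bottomOrder = 1 := rfl
    have h2 : leaf.branchCount (k + 1) = 0 := if_neg (by omega)
    rw [branchCount, if_neg (by omega)]; omega
  | hr l hl ih =>
    have := l.prune.bottomOrder_pos
    have := bottomOrder_prune hl
    rw [prune_node_leaf_right hl]
    have h1 : leaf.bottomOrder = 1 := rfl
    have h2 : leaf.branchCount (k + 1) = 0 := if_neg (by omega)
    rw [branchCount, if_neg (by omega)]; omega
  | hn l r hl hr ihl ihr =>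
    rw [prune_node_of_ne hl hr]
    simp only [branchCount, ihl, ihr, bottomOrder_prune hl, bottomOrder_prune hr,
      Nat.add_right_cancel_iff]

theorem eq_leaf_iff_bottomOrder {t : FullTree} : t = leaf ↔ t.bottomOrder = 1 := by
  refine ⟨fun h => h ▸ rfl, fun h => ?_⟩
  by_contra ht
  have := bottomOrder_prune ht
  have := t.prune.bottomOrder_pos
  omega

theorem finite_leaves_le (n : ℕ) : {t : FullTree | t.leaves ≤ n}.Finite := by
  induction n with
  | zero =>
    refine Set.Finite.subset Set.finite_empty fun t (ht : t.leaves ≤ 0) => ?_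
    have := t.leaves_pos
    omega
  | succ n ih =>
    refine ((Set.finite_singleton leaf).union (ih.image2 node ih)).subset ?_
    intro t (ht : t.leaves ≤ n + 1)
    cases t with
    | leaf => exact Or.inl rfl
    | node l r =>
      have := l.leaves_pos
      have := r.leaves_pos
      simp only [leaves] at ht
      exact Or.inr ⟨l, show l.leaves ≤ n by omega, r, show r.leaves ≤ n by omega, rfl⟩

/-! ### The fibres of the pruning map -/

/-- The trees with an inner vertex whose pruning is `s` and which have `m` leaves more than the
smallest such trees. -/
noncomputable def pruneFibre (s : FullTree) (m : ℕ) : Finset FullTree :=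
  Set.Finite.toFinset (s := {t | t ≠ leaf ∧ t.prune = s ∧ t.leaves = 2 * s.leaves + m})
    ((finite_leaves_le (2 * s.leaves + m)).subset fun _ h => h.2.2.le)

theorem mem_pruneFibre {s t : FullTree} {m : ℕ} :
    t ∈ pruneFibre s m ↔ t ≠ leaf ∧ t.prune = s ∧ t.leaves = 2 * s.leaves + m := by
  simp [pruneFibre]

open Classical in
/-- The trees whose bottom vertex has a leaf as one child and carries a tree of `F` on the other
side. If `F` is a fibre of the pruning map, these belong to the fibre with one more leaf. -/
noncomputable def graftLeaf (F : Finset FullTree) : Finset FullTree :=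
  F.image (node leaf) ∪ F.image (node · leaf)

open Classical in
/-- The trees of the fibre `pruneFibre (node a b) m` in which the two subtrees of the bottom vertex
are pruned to `a` and `b`. -/
noncomputable def joinFibres (a b : FullTree) (m : ℕ) : Finset FullTree :=
  (Finset.HasAntidiagonal.antidiagonal m).biUnion fun p =>
    (pruneFibre a p.1 ×ˢ pruneFibre b p.2).image fun q => node q.1 q.2

theorem mem_graftLeaf {F : Finset FullTree} {t : FullTree} :
    t ∈ graftLeaf F ↔ (∃ r ∈ F, node leaf r = t) ∨ ∃ l ∈ F, node l leaf = t := by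
  simp [graftLeaf]

theorem mem_joinFibres {a b t : FullTree} {m : ℕ} :
    t ∈ joinFibres a b m ↔ ∃ l r, l ≠ leaf ∧ r ≠ leaf ∧ t = node l r ∧ l.prune = a ∧
      r.prune = b ∧ t.leaves = 2 * (a.leaves + b.leaves) + m := by
  simp only [joinFibres, Finset.mem_biUnion, Finset.HasAntidiagonal.mem_antidiagonal,
    Finset.mem_image, Finset.mem_product, Prod.exists, mem_pruneFibre]
  constructor
  · rintro ⟨i, j, hij, l, r, ⟨⟨h1, h2, h3⟩, h4, h5, h6⟩, rfl⟩
    exact ⟨l, r, h1, h4, rfl, h2, h5, by simp only [leaves]; omega⟩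
  · rintro ⟨l, r, h1, h2, rfl, rfl, rfl, h⟩
    simp only [leaves] at h
    have := two_mul_leaves_prune_le h1
    have := two_mul_leaves_prune_le h2
    exact ⟨l.leaves - 2 * l.prune.leaves, r.leaves - 2 * r.prune.leaves, by omega, l, r,
      ⟨⟨h1, rfl, by omega⟩, h2, rfl, by omega⟩, rfl⟩

theorem card_graftLeaf (s : FullTree) (m : ℕ) :
    (graftLeaf (pruneFibre s m)).card = 2 * (pruneFibre s m).card := by
  classical
  rw [graftLeaf, Finset.card_union_of_disjoint, Finset.card_image_of_injective,
    Finset.card_image_of_injective, two_mul]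
  · intro a b h; injection h
  · intro a b h; injection h
  · rw [Finset.disjoint_left]
    intro t h1 h2
    obtain ⟨r, hr, rfl⟩ := Finset.mem_image.1 h1
    obtain ⟨l, hl, h⟩ := Finset.mem_image.1 h2
    injection h with h3 h4
    exact (mem_pruneFibre.1 hr).1 h4.symm

theorem card_joinFibres (a b : FullTree) (m : ℕ) :
    (joinFibres a b m).card = ∑ p ∈ Finset.HasAntidiagonal.antidiagonal m,
      (pruneFibre a p.1).card * (pruneFibre b p.2).card := by
  classical
  rw [joinFibres, Finset.card_biUnion]
  · refine Finset.sum_congr rfl fun p _ => ?_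
    rw [Finset.card_image_of_injective, Finset.card_product]
    rintro ⟨a, b⟩ ⟨c, d⟩ h
    injection h with h1 h2
    exact Prod.ext h1 h2
  · intro p _ p' _ hne
    simp only [Function.onFun]
    rw [Finset.disjoint_left]
    rintro t h1 h2
    obtain ⟨⟨l, r⟩, h3, rfl⟩ := Finset.mem_image.1 h1
    obtain ⟨⟨l', r'⟩, h4, h⟩ := Finset.mem_image.1 h2
    injection h with h5 h6
    simp only at h5 h6
    subst h5 h6
    simp only [Finset.mem_product, mem_pruneFibre] at h3 h4
    exact hne (Prod.ext (by omega) (by omega))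

theorem disjoint_graftLeaf_joinFibres (F : Finset FullTree) (a b : FullTree) (m : ℕ) :
    Disjoint (graftLeaf F) (joinFibres a b m) := by
  rw [Finset.disjoint_left]
  intro t h1 h2
  obtain ⟨l, r, hl, hr, rfl, -⟩ := mem_joinFibres.1 h2
  rcases mem_graftLeaf.1 h1 with ⟨x, -, h⟩ | ⟨x, -, h⟩
  · injection h with h3 h4; exact hl h3.symm
  · injection h with h3 h4; exact hr h4.symm

theorem pruneFibre_leaf_zero : pruneFibre leaf 0 = {node leaf leaf} := by
  ext t
  rw [mem_pruneFibre, Finset.mem_singleton]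
  constructor
  · rintro ⟨h1, -, h3⟩
    cases t with
    | leaf => exact absurd rfl h1
    | node l r =>
      simp only [leaves] at h3
      have := l.bottomOrder_pos
      have := r.bottomOrder_pos
      have := l.bottomOrder_le_leaves
      have := r.bottomOrder_le_leaves
      rw [eq_leaf_iff_bottomOrder.2 (show l.bottomOrder = 1 by omega),
        eq_leaf_iff_bottomOrder.2 (show r.bottomOrder = 1 by omega)]
  · rintro rfl
    simp [prune, leaves]

theorem mem_graftLeaf_pruneFibre {s t : FullTree} {m : ℕ} :
    t ∈ graftLeaf (pruneFibre s m) ↔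
      (∃ r, r ≠ leaf ∧ (t = node leaf r ∨ t = node r leaf)) ∧ t.prune = s ∧
        t.leaves = 2 * s.leaves + (m + 1) := by
  rw [mem_graftLeaf]
  constructor
  · rintro (⟨r, hr, rfl⟩ | ⟨r, hr, rfl⟩)
    · obtain ⟨h1, h2, h3⟩ := mem_pruneFibre.1 hr
      exact ⟨⟨r, h1, Or.inl rfl⟩, by rw [prune_node_leaf_left h1, h2],
        by simp only [leaves]; omega⟩
    · obtain ⟨h1, h2, h3⟩ := mem_pruneFibre.1 hr
      exact ⟨⟨r, h1, Or.inr rfl⟩, by rw [prune_node_leaf_right h1, h2],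
        by simp only [leaves]; omega⟩
  · rintro ⟨⟨r, h1, (rfl | rfl)⟩, h2, h3⟩
    · rw [prune_node_leaf_left h1] at h2
      simp only [leaves] at h3
      exact Or.inl ⟨r, mem_pruneFibre.2 ⟨h1, h2, by omega⟩, rfl⟩
    · rw [prune_node_leaf_right h1] at h2
      simp only [leaves] at h3
      exact Or.inr ⟨r, mem_pruneFibre.2 ⟨h1, h2, by omega⟩, rfl⟩

theorem pruneFibre_leaf_succ (m : ℕ) :
    pruneFibre leaf (m + 1) = graftLeaf (pruneFibre leaf m) := by
  ext t
  rw [mem_pruneFibre, mem_graftLeaf_pruneFibre]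
  constructor
  · rintro ⟨h1, h2, h3⟩
    refine ⟨?_, h2, h3⟩
    induction t, h1 using induction_ne_leaf with
    | h0 => simp only [leaves] at h3; omega
    | hl r hr => exact ⟨r, hr, Or.inl rfl⟩
    | hr r hr => exact ⟨r, hr, Or.inr rfl⟩
    | hn l r hl hr => rw [prune_node_of_ne hl hr] at h2; cases h2
  · rintro ⟨⟨r, -, (rfl | rfl)⟩, h2, h3⟩
    · exact ⟨by simp, h2, h3⟩
    · exact ⟨by simp, h2, h3⟩

theorem pruneFibre_node_zero (a b : FullTree) : pruneFibre (node a b) 0 = joinFibres a b 0 := by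
  ext t
  rw [mem_pruneFibre, mem_joinFibres]
  constructor
  · rintro ⟨h1, h2, h3⟩
    induction t, h1 using induction_ne_leaf with
    | h0 => cases h2
    | hl r hr =>
      have := two_mul_leaves_prune_le hr
      rw [prune_node_leaf_left hr] at h2
      rw [h2] at this
      simp only [leaves] at *; omega
    | hr r hr =>
      have := two_mul_leaves_prune_le hr
      rw [prune_node_leaf_right hr] at h2
      rw [h2] at this
      simp only [leaves] at *; omega
    | hn l r hl hr =>
      rw [prune_node_of_ne hl hr] at h2
      injection h2 with h4 h5
      exact ⟨l, r, hl, hr, rfl, h4, h5, h3⟩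
  · rintro ⟨l, r, hl, hr, rfl, rfl, rfl, h⟩
    exact ⟨by simp, prune_node_of_ne hl hr, h⟩

open Classical in
theorem pruneFibre_node_succ (a b : FullTree) (m : ℕ) :
    pruneFibre (node a b) (m + 1) =
      graftLeaf (pruneFibre (node a b) m) ∪ joinFibres a b (m + 1) := by
  ext t
  rw [Finset.mem_union, mem_pruneFibre, mem_joinFibres, mem_graftLeaf_pruneFibre]
  constructor
  · rintro ⟨h1, h2, h3⟩
    induction t, h1 using induction_ne_leaf with
    | h0 => cases h2
    | hl r hr => exact Or.inl ⟨⟨r, hr, Or.inl rfl⟩, h2, h3⟩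
    | hr r hr => exact Or.inl ⟨⟨r, hr, Or.inr rfl⟩, h2, h3⟩
    | hn l r hl hr =>
      rw [prune_node_of_ne hl hr] at h2
      injection h2 with h4 h5
      exact Or.inr ⟨l, r, hl, hr, rfl, h4, h5, h3⟩
  · rintro (⟨⟨r, -, (rfl | rfl)⟩, h2, h3⟩ | ⟨l, r, hl, hr, rfl, rfl, rfl, h⟩)
    · exact ⟨by simp, h2, h3⟩
    · exact ⟨by simp, h2, h3⟩
    · exact ⟨by simp, prune_node_of_ne hl hr, h⟩

/-- A tree with `n` leaves has `2 n - 1` edges (counting the stem), and a tree of its fibre arises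
by attaching two leaves to every leaf and `m` further leaves along the edges, each of them on
the left or on the right. -/
theorem card_pruneFibre (s : FullTree) (m : ℕ) :
    (pruneFibre s m).card = 2 ^ m * ((2 * s.leaves - 2) + m).choose (2 * s.leaves - 2) := by
  classical
  induction s generalizing m with
  | leaf =>
    simp only [leaves, mul_one, Nat.sub_self, Nat.choose_zero_right]
    induction m with
    | zero => rw [pruneFibre_leaf_zero]; rfl
    | succ m ih => rw [pruneFibre_leaf_succ, card_graftLeaf, ih, pow_succ, mul_comm]
  | node a b iha ihb =>
    have ha := a.leaves_pos
    have hb := b.leaves_pos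
    set d := (2 * a.leaves - 2) + (2 * b.leaves - 2) + 1 with hd
    have hd' : 2 * (node a b).leaves - 2 = d + 1 := by simp only [leaves]; omega
    -- There are `d + 2` edges, `d + 1` of them above the bottom vertex.
    have hjoin : ∀ m, (joinFibres a b m).card = 2 ^ m * (d + m).choose d := by
      intro m
      rw [card_joinFibres, hd, ← Nat.sum_antidiagonal_add_choose_mul, Finset.mul_sum]
      refine Finset.sum_congr rfl fun p hp => ?_
      rw [iha, ihb, ← Finset.HasAntidiagonal.mem_antidiagonal.1 hp, pow_add]
      ring
    rw [hd']
    induction m with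
    | zero => rw [pruneFibre_node_zero, hjoin]; simp
    | succ m ih =>
      rw [pruneFibre_node_succ, Finset.card_union_of_disjoint
        (disjoint_graftLeaf_joinFibres _ _ _ _), card_graftLeaf, ih, hjoin,
        show d + 1 + (m + 1) = (d + (m + 1)) + 1 by ring, Nat.choose_succ_succ,
        show d + 1 + m = d + (m + 1) by ring]
      ring

/-! ### Counting trees with prescribed branch numbers -/

/-- The trees of order `n + 1` with `a j` branches of order `n + 1 - j` for `j = 0, …, n`. Counting
the orders from the top makes the pruning step extend the same sequence `a`. -/
def profileSet (a : ℕ → ℕ) (n : ℕ) : Set FullTree :=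
  {t | t.bottomOrder = n + 1 ∧ ∀ j ≤ n, t.branchCount (n + 1 - j) = a j}

theorem leaves_of_mem_profileSet {a : ℕ → ℕ} {n : ℕ} {t : FullTree} (ht : t ∈ profileSet a n) :
    t.leaves = a n := by
  rw [← branchCount_one, ← ht.2 n le_rfl]
  congr 1; omega

theorem finite_profileSet (a : ℕ → ℕ) (n : ℕ) : (profileSet a n).Finite :=
  (finite_leaves_le (a n)).subset fun _ ht => (leaves_of_mem_profileSet ht).le

theorem mem_profileSet_succ {a : ℕ → ℕ} {n : ℕ} {t : FullTree} :
    t ∈ profileSet a (n + 1) ↔ t ≠ leaf ∧ t.prune ∈ profileSet a n ∧ t.leaves = a (n + 1) := by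
  constructor
  · intro ht
    have h1 : t ≠ leaf := by
      rw [Ne, eq_leaf_iff_bottomOrder, ht.1]; omega
    refine ⟨h1, ⟨?_, fun j hj => ?_⟩, leaves_of_mem_profileSet ht⟩
    · have := bottomOrder_prune h1
      have := ht.1
      omega
    · rw [← branchCount_prune h1 (by omega), ← ht.2 j (by omega)]
      congr 1; omega
  · rintro ⟨h1, h2, h3⟩
    refine ⟨by rw [bottomOrder_prune h1, h2.1], fun j hj => ?_⟩
    rcases Nat.lt_or_ge n j with h | h
    · obtain rfl : j = n + 1 := by omega
      rw [← h3, ← branchCount_one]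
      congr 1; omega
    · rw [← h2.2 j h, ← branchCount_prune h1 (by omega)]
      congr 1; omega

theorem profileSet_zero {a : ℕ → ℕ} (ha : a 0 = 1) : profileSet a 0 = {leaf} := by
  ext t
  rw [Set.mem_singleton_iff, eq_leaf_iff_bottomOrder]
  refine ⟨fun h => h.1, fun h => ⟨h, fun j hj => ?_⟩⟩
  obtain rfl : j = 0 := by omega
  rw [eq_leaf_iff_bottomOrder.2 h, ha]; rfl

/-- The number of ways to extend a tree with `x` leaves to one with `y` leaves that is pruned
to it. -/
def extensionCount (x y : ℕ) : ℕ := 2 ^ (y - 2 * x) * (y - 2).choose (2 * x - 2)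

theorem ncard_profileSet_succ {a : ℕ → ℕ} {n : ℕ} (ha : 2 * a n ≤ a (n + 1)) :
    (profileSet a (n + 1)).ncard = (profileSet a n).ncard * extensionCount (a n) (a (n + 1)) := by
  classical
  have h : profileSet a (n + 1) = ((finite_profileSet a n).toFinset.biUnion
      fun s => pruneFibre s (a (n + 1) - 2 * a n) : Finset FullTree) := by
    ext t
    simp only [Finset.coe_biUnion, Set.Finite.coe_toFinset, Set.mem_iUnion, Finset.mem_coe,
      mem_pruneFibre, exists_prop, mem_profileSet_succ]
    constructor
    · rintro ⟨h1, h2, h3⟩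
      have := leaves_of_mem_profileSet h2
      exact ⟨t.prune, h2, h1, rfl, by omega⟩
    · rintro ⟨s, hs, h1, rfl, h3⟩
      have := leaves_of_mem_profileSet hs
      exact ⟨h1, hs, by omega⟩
  rw [h, Set.ncard_coe_finset, Finset.card_biUnion,
    Set.ncard_eq_toFinset_card _ (finite_profileSet a n), Finset.sum_const_nat]
  · intro s hs
    have hs' := leaves_of_mem_profileSet ((finite_profileSet a n).mem_toFinset.1 hs)
    have := s.leaves_pos
    rw [card_pruneFibre, hs', extensionCount]
    congr 2
    omega
  · intro s _ s' _ hne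
    simp only [Function.onFun]
    rw [Finset.disjoint_left]
    intro t h1 h2
    exact hne ((mem_pruneFibre.1 h1).2.1.symm.trans (mem_pruneFibre.1 h2).2.1)

/-- The product formula for the number of trees with prescribed branch numbers. -/
theorem ncard_profileSet {a : ℕ → ℕ} (h0 : a 0 = 1) {n : ℕ}
    (ha : ∀ j < n, 2 * a j ≤ a (j + 1)) :
    (profileSet a n).ncard = ∏ j ∈ Finset.range n, extensionCount (a j) (a (j + 1)) := by
  induction n with
  | zero => rw [profileSet_zero h0]; simp
  | succ n ih =>
    rw [ncard_profileSet_succ (ha n n.lt_succ_self), Finset.prod_range_succ,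
      ih fun j hj => ha j (hj.trans n.lt_succ_self)]

theorem profile_of_mem_profileSet {a : ℕ → ℕ} {n : ℕ} {t : FullTree} (ht : t ∈ profileSet a n) :
    a 0 = 1 ∧ ∀ j < n, 2 * a j ≤ a (j + 1) := by
  induction n generalizing t with
  | zero =>
    obtain rfl := eq_leaf_iff_bottomOrder.2 ht.1
    exact ⟨(ht.2 0 le_rfl).symm, fun j hj => absurd hj (Nat.not_lt_zero j)⟩
  | succ n ih =>
    obtain ⟨h1, h2, h3⟩ := mem_profileSet_succ.1 ht
    refine ⟨(ih h2).1, fun j hj => ?_⟩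
    rcases Nat.lt_succ_iff_lt_or_eq.1 hj with h | rfl
    · exact (ih h2).2 j h
    · rw [← leaves_of_mem_profileSet h2, ← h3]
      exact two_mul_leaves_prune_le h1

end FullTree

open FullTree

/-! ### The trees of a Horton space, sorted by their branch numbers -/

/-- The numbers of branches of a tree of order `n + 1`, listed from the top order `n + 1`
downwards. -/
def branchProfile (n : ℕ) (t : FullTree) (j : ℕ) : ℕ := t.branchCount (n + 1 - j)

/-- The sequences `a 0, …, a n` that can be the branch numbers, listed from the top order
downwards, of a tree in the Horton space of order `n + 1`. -/
structure IsProfile (R α : ℝ) (n : ℕ) (a : ℕ → ℕ) : Prop where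
  zero : a 0 = 1
  two_mul_le : ∀ j < n, 2 * a j ≤ a (j + 1)
  abs_sub_lt : ∀ j ≤ n, |(a j : ℝ) - R ^ j| < α ^ j

theorem mem_hortonSpace_succ {R α : ℝ} {n : ℕ} {T : PlantedTree} :
    T ∈ hortonSpace (n + 1) R α ↔ T.top.bottomOrder = n + 1 ∧
      ∀ j ≤ n, |(branchProfile n T.top j : ℝ) - R ^ j| < α ^ j := by
  simp only [hortonSpace, Set.mem_ofPred_eq, T.hasOrder_iff, T.hortonNumber_eq, Finset.mem_Icc,
    Set.mem_Ioo, branchProfile, abs_sub_lt_iff]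
  refine and_congr_right fun _ => ⟨fun h j hj => ?_, fun h k hk => ?_⟩
  · have := h (n + 1 - j) (by omega)
    rw [show n + 1 - (n + 1 - j) = j by omega] at this
    constructor <;> linarith [this.1, this.2]
  · have := h (n + 1 - k) (by omega)
    rw [show n + 1 - (n + 1 - k) = k by omega] at this
    constructor <;> linarith [this.1, this.2]

theorem mem_profileSet_branchProfile {R α : ℝ} {n : ℕ} {T : PlantedTree}
    (hT : T ∈ hortonSpace (n + 1) R α) : T.top ∈ profileSet (branchProfile n T.top) n :=
  ⟨(mem_hortonSpace_succ.1 hT).1, fun _ _ => rfl⟩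

theorem isProfile_branchProfile {R α : ℝ} {n : ℕ} {T : PlantedTree}
    (hT : T ∈ hortonSpace (n + 1) R α) : IsProfile R α n (branchProfile n T.top) :=
  ⟨(profile_of_mem_profileSet (mem_profileSet_branchProfile hT)).1,
    (profile_of_mem_profileSet (mem_profileSet_branchProfile hT)).2,
    (mem_hortonSpace_succ.1 hT).2⟩

theorem numVertices_eq_branchProfile {R α : ℝ} {n : ℕ} {T : PlantedTree}
    (hT : T ∈ hortonSpace (n + 1) R α) : T.numVertices = 2 * branchProfile n T.top n := by
  rw [T.numVertices_eq, leaves_of_mem_profileSet (mem_profileSet_branchProfile hT)]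

theorem mem_hortonSpaceOfSize_of_mem_profileSet {R α : ℝ} {n : ℕ} {a : ℕ → ℕ}
    (ha : IsProfile R α n a) {t : FullTree} (ht : t ∈ profileSet a n) :
    (⟨t⟩ : PlantedTree) ∈ hortonSpaceOfSize (n + 1) R α (2 * a n) := by
  have h : (⟨t⟩ : PlantedTree) ∈ hortonSpace (n + 1) R α := by
    refine mem_hortonSpace_succ.2 ⟨ht.1, fun j hj => ?_⟩
    rw [branchProfile, ht.2 j hj]
    exact ha.abs_sub_lt j hj
  exact ⟨h, by rw [PlantedTree.numVertices_eq, leaves_of_mem_profileSet ht]⟩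

theorem extensionCount_pos {x y : ℕ} (h : 2 * x ≤ y) : 0 < extensionCount x y :=
  Nat.mul_pos (by positivity) (Nat.choose_pos (by omega))

theorem IsProfile.ncard_pos {R α : ℝ} {n : ℕ} {a : ℕ → ℕ} (ha : IsProfile R α n a) :
    0 < (profileSet a n).ncard := by
  rw [ncard_profileSet ha.zero ha.two_mul_le]
  exact Finset.prod_pos fun j hj =>
    extensionCount_pos (ha.two_mul_le j (Finset.mem_range.1 hj))

/-- The integer parts of the powers of `R` form a profile. -/
theorem isProfile_floor {R α : ℝ} (hR : 2 ≤ R) (hα : 1 < α) (n : ℕ) :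
    IsProfile R α n fun j => ⌊R ^ j⌋₊ := by
  have h0 : (0 : ℝ) ≤ R := by linarith
  refine ⟨by simp, fun j _ => Nat.le_floor ?_, fun j _ => ?_⟩
  · have := Nat.floor_le (pow_nonneg h0 j)
    push_cast
    rw [pow_succ, mul_comm (R ^ j)]
    gcongr
  · have h1 := Nat.floor_le (pow_nonneg h0 j)
    have h2 := Nat.lt_floor_add_one (R ^ j)
    have h3 : 1 ≤ α ^ j := one_le_pow₀ hα.le
    rw [abs_sub_lt_iff]
    constructor <;> linarith

theorem hortonSpace_nonempty {R α : ℝ} (hR : 2 ≤ R) (hα : 1 < α) (n : ℕ) :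
    (hortonSpace (n + 1) R α).Nonempty := by
  have h := isProfile_floor hR hα n
  obtain ⟨t, ht⟩ := Set.nonempty_of_ncard_ne_zero h.ncard_pos.ne'
  exact ⟨⟨t⟩, (mem_hortonSpaceOfSize_of_mem_profileSet h ht).1⟩

theorem IsProfile.lt_two_mul_pow {R α : ℝ} (hα : 1 < α) (hαR : α < R) {n : ℕ}
    {a : ℕ → ℕ} (ha : IsProfile R α n a) {j : ℕ} (hj : j ≤ n) : (a j : ℝ) < 2 * R ^ n := by
  have h1 := (abs_sub_lt_iff.1 (ha.abs_sub_lt j hj)).1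
  have h2 : α ^ j ≤ R ^ j := by gcongr
  have h3 : R ^ j ≤ R ^ n := pow_le_pow_right₀ (by linarith) hj
  linarith

theorem hortonSpace_finite {R α : ℝ} (hα : 1 < α) (hαR : α < R) (n : ℕ) :
    (hortonSpace (n + 1) R α).Finite := by
  refine Set.Finite.subset ((finite_leaves_le ⌊2 * R ^ n⌋₊).image PlantedTree.mk) ?_
  intro T hT
  refine ⟨T.top, ?_, rfl⟩
  change T.top.leaves ≤ _
  rw [leaves_of_mem_profileSet (mem_profileSet_branchProfile hT)]
  exact Nat.le_floor ((isProfile_branchProfile hT).lt_two_mul_pow hα hαR le_rfl).le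

theorem PlantedTree.mk_injective : Function.Injective PlantedTree.mk := by
  intro a b h; injection h

theorem ncard_profileSet_le {R α : ℝ} (hα : 1 < α) (hαR : α < R) {n : ℕ}
    {a : ℕ → ℕ} (ha : IsProfile R α n a) :
    (profileSet a n).ncard ≤ (hortonSpaceOfSize (n + 1) R α (2 * a n)).ncard := by
  rw [← Set.ncard_image_of_injective _ PlantedTree.mk_injective]
  refine Set.ncard_le_ncard ?_ ((hortonSpace_finite hα hαR n).subset fun _ h => h.1)
  rintro _ ⟨t, ht, rfl⟩
  exact mem_hortonSpaceOfSize_of_mem_profileSet ha ht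

/-- There are few profiles, so that the trees of a most frequent profile make up a large part of
the Horton space. -/
theorem exists_isProfile_ncard_hortonSpace_le {R α : ℝ} (hR : 2 ≤ R) (hα : 1 < α) (hαR : α < R)
    (n : ℕ) : ∃ a, IsProfile R α n a ∧
      (hortonSpace (n + 1) R α).ncard ≤ (profileSet a n).ncard * ⌈2 * R ^ n⌉₊ ^ (n + 1) := by
  classical
  have hfin := hortonSpace_finite hα hαR n
  obtain ⟨T, hT, hmax⟩ := Set.exists_max_image _
    (fun T : PlantedTree => (profileSet (branchProfile n T.top) n).ncard) hfin
    (hortonSpace_nonempty hR hα n)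
  refine ⟨_, isProfile_branchProfile hT, ?_⟩
  rw [Set.ncard_eq_toFinset_card _ hfin]
  let f : PlantedTree → Fin (n + 1) → ℕ := fun T i => branchProfile n T.top i
  refine (Finset.card_le_mul_card_image (f := f) hfin.toFinset
    (profileSet (branchProfile n T.top) n).ncard ?_).trans (Nat.mul_le_mul_left _ ?_)
  · intro b hb
    obtain ⟨S, hS, rfl⟩ := Finset.mem_image.1 hb
    rw [Set.Finite.mem_toFinset] at hS
    refine le_trans ?_ (hmax S hS)
    rw [← Set.ncard_coe_finset, ← Set.ncard_image_of_injective (profileSet _ n)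
      PlantedTree.mk_injective]
    refine Set.ncard_le_ncard ?_ ((finite_profileSet _ _).image _)
    intro U hU
    simp only [Finset.coe_filter, Set.Finite.mem_toFinset, Set.mem_ofPred_eq] at hU
    refine ⟨U.top, ⟨(mem_hortonSpace_succ.1 hU.1).1, fun j hj => ?_⟩, rfl⟩
    exact congrFun hU.2 ⟨j, by omega⟩
  · refine (Finset.card_le_card (t := Fintype.piFinset
      fun _ : Fin (n + 1) => Finset.range ⌈2 * R ^ n⌉₊) ?_).trans (by simp)
    intro b hb
    obtain ⟨S, hS, rfl⟩ := Finset.mem_image.1 hb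
    rw [Set.Finite.mem_toFinset] at hS
    refine Fintype.mem_piFinset.2 fun i => Finset.mem_range.2 (Nat.lt_ceil.2 ?_)
    exact (isProfile_branchProfile hS).lt_two_mul_pow hα hαR (Nat.lt_succ_iff.1 i.2)

theorem le_numVertices_of_mem_hortonSpace {K : ℕ} {R α : ℝ} {T : PlantedTree}
    (hT : T ∈ hortonSpace K R α) : K ≤ T.numVertices := by
  have h1 := (T.hasOrder_iff K).1 hT.1
  have h2 := T.top.bottomOrder_le_leaves
  rw [T.numVertices_eq]
  omega

/-! ### Entropy of a uniform distribution -/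

theorem shannonEntropy_uniformMass {X : Type*} {S : Set X} (hS : S.Finite) (hne : S.Nonempty) :
    shannonEntropy (uniformMass S) = Real.logb 2 (S.ncard : ℝ) := by
  have hc : (S.ncard : ℝ) ≠ 0 := by
    exact_mod_cast ((Set.ncard_pos hS).2 hne).ne'
  rw [shannonEntropy, tsum_eq_sum (s := hS.toFinset)]
  · rw [Finset.sum_congr rfl (g := fun _ => 1 / (S.ncard : ℝ) * Real.logb 2 (1 / (S.ncard : ℝ)))]
    · rw [Finset.sum_const, ← Set.ncard_eq_toFinset_card _ hS, nsmul_eq_mul, one_div,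
        Real.logb_inv]
      field_simp
    · intro x hx
      rw [uniformMass, Set.indicator_of_mem (hS.mem_toFinset.1 hx)]
  · intro x hx
    rw [uniformMass, Set.indicator_of_notMem (fun h => hx (hS.mem_toFinset.2 h)), zero_mul]

end Horton

/-! ### Binomial coefficients and binary entropy -/

/-- A weak form of Stirling's formula with explicit error terms, valid for all `n`. -/
theorem Real.log_factorial_sub_mem_Icc (n : ℕ) :
    Real.log n.factorial - (n * Real.log n - n) ∈ Set.Icc 0 (1 + Real.log n) := by
  rcases Nat.eq_zero_or_pos n with rfl | hn
  · simp
  induction n, hn using Nat.le_induction with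
  | base => simp
  | succ n hn ih =>
    have hn0 : (0 : ℝ) < n := by exact_mod_cast hn
    have hlog : Real.log ((n + 1 : ℝ) / n) = Real.log (n + 1) - Real.log n :=
      Real.log_div (by positivity) (by positivity)
    have h1 := Real.log_le_sub_one_of_pos (show 0 < (n + 1 : ℝ) / n by positivity)
    have h2 := Real.one_sub_inv_le_log_of_pos (show 0 < (n + 1 : ℝ) / n by positivity)
    rw [hlog] at h1 h2
    have h3 : n * (Real.log (n + 1) - Real.log n) ≤ 1 := by
      calc n * (Real.log (n + 1) - Real.log n) ≤ n * ((n + 1 : ℝ) / n - 1) := by gcongr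
        _ = 1 := by field_simp; ring
    have h4 : 1 ≤ (n + 1) * (Real.log (n + 1) - Real.log n) := by
      calc (1 : ℝ) = (n + 1) * (1 - ((n + 1 : ℝ) / n)⁻¹) := by field_simp; ring
        _ ≤ _ := by gcongr
    rw [Nat.factorial_succ]
    push_cast
    rw [Real.log_mul (by positivity) (by positivity)]
    obtain ⟨h5, h6⟩ := ih
    constructor <;> linarith

theorem Real.natCast_mul_log_div (k n : ℕ) (hn : n ≠ 0) :
    k * Real.log ((k : ℝ) / n) = k * Real.log k - k * Real.log n := by
  rcases Nat.eq_zero_or_pos k with rfl | hk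
  · simp
  · rw [Real.log_div (by positivity) (by positivity)]; ring

theorem Real.natCast_mul_binEntropy_div {k n : ℕ} (h : k ≤ n) :
    n * Real.binEntropy ((k : ℝ) / n) =
      n * Real.log n - k * Real.log k - (n - k : ℕ) * Real.log (n - k : ℕ) := by
  rcases Nat.eq_zero_or_pos n with rfl | hn
  · obtain rfl : k = 0 := by omega
    simp
  have hn0 : (n : ℝ) ≠ 0 := by positivity
  have h1 : 1 - (k : ℝ) / n = ((n - k : ℕ) : ℝ) / n := by
    rw [Nat.cast_sub h]; field_simp
  have h2 := Real.natCast_mul_log_div k n hn.ne'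
  have h3 := Real.natCast_mul_log_div (n - k) n hn.ne'
  have h4 : ((n - k : ℕ) : ℝ) = n - k := Nat.cast_sub h
  rw [Real.binEntropy, h1, Real.log_inv, Real.log_inv]
  calc _ = -(k * Real.log ((k : ℝ) / n)) - (n - k : ℕ) * Real.log (((n - k : ℕ) : ℝ) / n) := by
        field_simp
        ring
    _ = _ := by rw [h2, h3]; rw [h4]; ring

theorem Real.abs_log_choose_sub_le {k n : ℕ} (h : k ≤ n) :
    |Real.log (n.choose k) - n * Real.binEntropy ((k : ℝ) / n)| ≤ 2 * (1 + Real.log n) := by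
  have hc : Real.log n.factorial =
      Real.log (n.choose k) + Real.log k.factorial + Real.log (n - k).factorial := by
    have h0 : (n.choose k : ℝ) ≠ 0 := by exact_mod_cast (Nat.choose_pos h).ne'
    rw [← Nat.choose_mul_factorial_mul_factorial h]
    push_cast
    rw [Real.log_mul (by positivity) (by positivity), Real.log_mul (by positivity) (by positivity)]
  have hmono : ∀ m ≤ n, Real.log m ≤ Real.log n := by
    intro m hm
    rcases Nat.eq_zero_or_pos m with rfl | hm0
    · simpa using Real.log_natCast_nonneg n
    · exact Real.log_le_log (by positivity) (by exact_mod_cast hm)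
  obtain ⟨h1, h2⟩ := Real.log_factorial_sub_mem_Icc n
  obtain ⟨h3, h4⟩ := Real.log_factorial_sub_mem_Icc k
  obtain ⟨h5, h6⟩ := Real.log_factorial_sub_mem_Icc (n - k)
  have h7 := hmono k h
  have h8 := hmono (n - k) (by omega)
  have h9 := Real.log_natCast_nonneg n
  have h10 : ((n - k : ℕ) : ℝ) = n - k := Nat.cast_sub h
  rw [Real.natCast_mul_binEntropy_div h, abs_sub_le_iff]
  constructor <;> linarith

theorem Real.abs_log_choose_sub_two_sub_le {k n : ℕ} (hk : 2 ≤ k) (h : k ≤ n) :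
    |Real.log ((n - 2).choose (k - 2)) - n * Real.binEntropy ((k : ℝ) / n)| ≤
      2 + 4 * Real.log n := by
  obtain ⟨k, rfl⟩ := Nat.exists_eq_add_of_le' hk
  obtain ⟨n, rfl⟩ := Nat.exists_eq_add_of_le' (hk.trans h)
  have hkn : k ≤ n := by omega
  simp only [Nat.add_sub_cancel]
  have e1 : (n + 2) * (n + 1) * n.choose k = (n + 2).choose (k + 2) * ((k + 2) * (k + 1)) := by
    have e2 := Nat.add_one_mul_choose_eq n k
    have e3 := Nat.add_one_mul_choose_eq (n + 1) (k + 1)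
    rw [mul_assoc, e2, ← mul_assoc, e3]; ring
  have c1 : ((n.choose k : ℕ) : ℝ) ≠ 0 := by exact_mod_cast (Nat.choose_pos hkn).ne'
  have c2 : (((n + 2).choose (k + 2) : ℕ) : ℝ) ≠ 0 := by exact_mod_cast (Nat.choose_pos h).ne'
  have e4 := congrArg (fun m : ℕ => Real.log m) e1
  simp only [Nat.cast_mul] at e4
  rw [Real.log_mul (by positivity) c1, Real.log_mul c2 (by positivity),
    Real.log_mul (by positivity) (by positivity),
    Real.log_mul (by positivity) (by positivity)] at e4
  have l1 : Real.log ((n + 1 : ℕ) : ℝ) ≤ Real.log ((n + 2 : ℕ) : ℝ) :=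
    Real.log_le_log (by positivity) (by push_cast; linarith)
  have l2 : Real.log ((k + 2 : ℕ) : ℝ) ≤ Real.log ((n + 2 : ℕ) : ℝ) :=
    Real.log_le_log (by positivity) (by exact_mod_cast h)
  have l3 : Real.log ((k + 1 : ℕ) : ℝ) ≤ Real.log ((n + 1 : ℕ) : ℝ) :=
    Real.log_le_log (by positivity) (by exact_mod_cast (by omega))
  have l4 := Real.log_natCast_nonneg (k + 1)
  have l5 := Real.log_natCast_nonneg (k + 2)
  have := abs_sub_le_iff.1 (Real.abs_log_choose_sub_le h)
  rw [abs_sub_le_iff]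
  constructor <;> linarith [this.1, this.2]

namespace Horton

open FullTree

/-! ### Growth of the number of extensions -/

theorem binaryEntropy_eq (z : ℝ) : binaryEntropy z = Real.binEntropy z / Real.log 2 := by
  rw [binaryEntropy, Real.binEntropy, Real.logb, Real.logb, Real.log_inv, Real.log_inv]
  ring

theorem continuous_binaryEntropy : Continuous binaryEntropy := by
  rw [show binaryEntropy = fun z => Real.binEntropy z / Real.log 2 from funext binaryEntropy_eq]
  fun_prop

theorem abs_logb_extensionCount_sub_le {x y : ℕ} (hx : 1 ≤ x) (hxy : 2 * x ≤ y) :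
    |Real.logb 2 (extensionCount x y) -
      ((y - 2 * x : ℝ) + y * binaryEntropy (2 * x / y))| ≤
        (2 + 4 * Real.log y) / Real.log 2 := by
  have h2 : 0 < Real.log 2 := Real.log_pos one_lt_two
  have hc : (((y - 2).choose (2 * x - 2) : ℕ) : ℝ) ≠ 0 := by
    exact_mod_cast (Nat.choose_pos (by omega)).ne'
  have h := Real.abs_log_choose_sub_two_sub_le (k := 2 * x) (by omega) hxy
  rw [extensionCount]
  push_cast at h ⊢
  rw [Real.logb_mul (by positivity) hc, Real.logb_pow, Real.logb_self_eq_one one_lt_two,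
    Nat.cast_sub hxy, Real.logb, binaryEntropy_eq]
  push_cast
  rw [show (y - 2 * x : ℝ) * 1 + Real.log ((y - 2).choose (2 * x - 2)) / Real.log 2 -
      ((y - 2 * x : ℝ) + y * (Real.binEntropy (2 * x / y) / Real.log 2)) =
      (Real.log ((y - 2).choose (2 * x - 2)) - y * Real.binEntropy (2 * x / y)) / Real.log 2 by
    ring, abs_div, abs_of_pos h2]
  gcongr

/-- The pairs of consecutive entries, at positions `j` and `j + 1`, that can occur in a profile. -/
def profileStep (R α : ℝ) (j : ℕ) : Set (ℕ × ℕ) :=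
  {p | 1 ≤ p.1 ∧ 2 * p.1 ≤ p.2 ∧ |(p.1 : ℝ) - R ^ j| < α ^ j ∧
    |(p.2 : ℝ) - R ^ (j + 1)| < α ^ (j + 1)}

/-- The limit of the number of bits per leaf that the choice of an extension contributes, when the
ratio of the numbers of leaves after and before the extension tends to `R`. -/
noncomputable def levelRate (R : ℝ) : ℝ := 1 - 2 / R + binaryEntropy (2 / R)

theorem tendsto_natCast_div_pow {ι : Type*} {l : Filter ι} {R α : ℝ} (hα : 1 < α) (hαR : α < R)
    {m x : ι → ℕ} (hm : Tendsto m l atTop) (hx : ∀ᶠ i in l, |(x i : ℝ) - R ^ m i| < α ^ m i) :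
    Tendsto (fun i => (x i : ℝ) / R ^ m i) l (𝓝 1) := by
  have hR : 0 < R := by linarith
  have h0 : Tendsto (fun i => (α / R) ^ m i) l (𝓝 0) :=
    (tendsto_pow_atTop_nhds_zero_of_lt_one (by positivity) ((div_lt_one hR).2 hαR)).comp hm
  rw [tendsto_iff_dist_tendsto_zero]
  refine squeeze_zero' (Eventually.of_forall fun _ => dist_nonneg) ?_ h0
  filter_upwards [hx] with i hi
  have hp : 0 < R ^ m i := by positivity
  rw [Real.dist_eq, div_pow, le_div_iff₀ hp]
  calc |(x i : ℝ) / R ^ m i - 1| * R ^ m i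
      = |((x i : ℝ) / R ^ m i - 1) * R ^ m i| := by rw [abs_mul, abs_of_pos hp]
    _ = |(x i : ℝ) - R ^ m i| := by congr 1; field_simp
    _ ≤ _ := hi.le

theorem tendsto_affine_div_pow {R : ℝ} (hR : 1 < R) (c d : ℝ) :
    Tendsto (fun n : ℕ => (c + d * n) / R ^ n) atTop (𝓝 0) := by
  have h0 := tendsto_pow_const_div_const_pow_of_one_lt 0 hR
  have h1 := tendsto_pow_const_div_const_pow_of_one_lt 1 hR
  have := (h0.const_mul c).add (h1.const_mul d)
  simp only [mul_zero, add_zero] at this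
  refine this.congr fun n => ?_
  simp only [pow_zero, pow_one]
  ring

/-- The logarithm of the number of extensions, per leaf, converges, uniformly over all steps that
can occur in a profile. -/
theorem tendsto_logb_extensionCount {R α : ℝ} (hR : 2 ≤ R) (hα : 1 < α) (hαR : α < R) :
    Tendsto (fun q : ℕ × ℕ × ℕ => Real.logb 2 (extensionCount q.2.1 q.2.2) / R ^ (q.1 + 1))
      (comap Prod.fst atTop ⊓ 𝓟 {q | q.2 ∈ profileStep R α q.1}) (𝓝 (levelRate R)) := by
  set l : Filter (ℕ × ℕ × ℕ) := comap Prod.fst atTop ⊓ 𝓟 {q | q.2 ∈ profileStep R α q.1}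
  have hR0 : 0 < R := by linarith
  have hl : ∀ᶠ q in l, q.2 ∈ profileStep R α q.1 := mem_inf_of_right (mem_principal_self _)
  have hj : Tendsto (fun q : ℕ × ℕ × ℕ => q.1) l atTop := tendsto_comap.mono_left inf_le_left
  have hj1 : Tendsto (fun q : ℕ × ℕ × ℕ => q.1 + 1) l atTop :=
    (tendsto_add_atTop_nat 1).comp hj
  have hx := tendsto_natCast_div_pow (x := fun q => q.2.1) hα hαR hj
    (hl.mono fun q hq => hq.2.2.1)
  have hy := tendsto_natCast_div_pow (x := fun q => q.2.2) hα hαR hj1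
    (hl.mono fun q hq => hq.2.2.2)
  have hxy : Tendsto (fun q : ℕ × ℕ × ℕ => 2 * (q.2.1 : ℝ) / q.2.2) l (𝓝 (2 / R)) := by
    have := (hx.div hy one_ne_zero).const_mul (2 / R)
    simp only [div_one, mul_one] at this
    refine this.congr' ?_
    filter_upwards [hl] with q hq
    have hq2 : (0 : ℝ) < q.2.2 := by
      have := hq.1; have := hq.2.1
      exact_mod_cast (by omega : 0 < q.2.2)
    simp only [Pi.div_apply]
    rw [pow_succ]
    field_simp
  have hmain : Tendsto (fun q : ℕ × ℕ × ℕ => ((q.2.2 - 2 * q.2.1 : ℝ) +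
      q.2.2 * binaryEntropy (2 * q.2.1 / q.2.2)) / R ^ (q.1 + 1)) l (𝓝 (levelRate R)) := by
    have := (hy.sub (hx.const_mul (2 / R))).add
      (hy.mul ((continuous_binaryEntropy.tendsto _).comp hxy))
    simp only [mul_one, one_mul] at this
    refine this.congr fun q => ?_
    simp only [Function.comp_apply]
    field_simp
    ring
  have herr : Tendsto (fun q : ℕ × ℕ × ℕ =>
      ((2 + 4 * (Real.log 2 + (q.1 + 1 : ℕ) * Real.log R)) / Real.log 2) / R ^ (q.1 + 1)) l
      (𝓝 0) := by
    refine ((tendsto_affine_div_pow (by linarith : 1 < R) ((2 + 4 * Real.log 2) / Real.log 2)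
      (4 * Real.log R / Real.log 2)).comp hj1).congr fun q => ?_
    simp only [Function.comp_apply]
    ring
  have hdiff : Tendsto (fun q : ℕ × ℕ × ℕ =>
      Real.logb 2 (extensionCount q.2.1 q.2.2) / R ^ (q.1 + 1) - ((q.2.2 - 2 * q.2.1 : ℝ) +
      q.2.2 * binaryEntropy (2 * q.2.1 / q.2.2)) / R ^ (q.1 + 1)) l (𝓝 0) := by
    refine squeeze_zero_norm' ?_ herr
    filter_upwards [hl] with q hq
    have hq2 : (0 : ℝ) < q.2.2 := by
      have := hq.1; have := hq.2.1
      exact_mod_cast (by omega : 0 < q.2.2)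
    have hp : 0 < R ^ (q.1 + 1) := by positivity
    rw [← sub_div, Real.norm_eq_abs, abs_div, abs_of_pos hp]
    gcongr
    refine (abs_logb_extensionCount_sub_le hq.1 hq.2.1).trans ?_
    have h2 : 0 < Real.log 2 := Real.log_pos one_lt_two
    gcongr
    rw [← Real.log_pow, ← Real.log_mul (by norm_num) hp.ne']
    refine Real.log_le_log hq2 ?_
    have h3 := (abs_sub_lt_iff.1 hq.2.2.2).1
    have h4 : α ^ (q.1 + 1) ≤ R ^ (q.1 + 1) := by gcongr
    linarith
  simpa using hdiff.add hmain

/-- A quantity that tends to `0` uniformly over finite sets `A j` is dominated by a null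
sequence. -/
theorem exists_tendsto_zero_of_uniform {β : Type*} (A : ℕ → Set β) (hA : ∀ j, (A j).Finite)
    (f : ℕ → β → ℝ) (hf : ∀ ε > 0, ∃ J, ∀ j ≥ J, ∀ p ∈ A j, |f j p| ≤ ε) :
    ∃ e : ℕ → ℝ, Tendsto e atTop (𝓝 0) ∧ ∀ j, ∀ p ∈ A j, |f j p| ≤ e j := by
  have h0 : ∀ j, 0 ≤ sSup ((fun p => |f j p|) '' A j) := fun j =>
    Real.sSup_nonneg (by rintro _ ⟨p, -, rfl⟩; exact abs_nonneg _)
  refine ⟨fun j => sSup ((fun p => |f j p|) '' A j), ?_, fun j p hp => ?_⟩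
  · rw [Metric.tendsto_atTop]
    intro ε hε
    obtain ⟨J, hJ⟩ := hf (ε / 2) (half_pos hε)
    refine ⟨J, fun j hj => ?_⟩
    rw [Real.dist_0_eq_abs, abs_of_nonneg (h0 j)]
    refine lt_of_le_of_lt (Real.sSup_le ?_ (half_pos hε).le) (half_lt_self hε)
    rintro _ ⟨p, hp, rfl⟩
    exact hJ j hj p hp
  · exact le_csSup ((hA j).image _).bddAbove ⟨p, hp, rfl⟩

theorem finite_profileStep (R α : ℝ) (j : ℕ) : (profileStep R α j).Finite := by
  refine Set.Finite.subset ((Set.finite_Iic ⌈R ^ (j + 1) + α ^ (j + 1)⌉₊).prod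
    (Set.finite_Iic ⌈R ^ (j + 1) + α ^ (j + 1)⌉₊)) ?_
  rintro ⟨x, y⟩ ⟨-, h2, -, h4⟩
  simp only at h2 h4
  have h5 : y ≤ ⌈R ^ (j + 1) + α ^ (j + 1)⌉₊ := by
    have h6 : (y : ℝ) ≤ ⌈R ^ (j + 1) + α ^ (j + 1)⌉₊ :=
      le_trans (by linarith [(abs_sub_lt_iff.1 h4).1]) (Nat.le_ceil _)
    exact_mod_cast h6
  exact ⟨show x ≤ _ by omega, h5⟩

theorem exists_abs_logb_extensionCount_sub_le {R α : ℝ} (hR : 2 ≤ R) (hα : 1 < α) (hαR : α < R) :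
    ∃ e : ℕ → ℝ, Tendsto e atTop (𝓝 0) ∧ ∀ j, ∀ p ∈ profileStep R α j,
      |Real.logb 2 (extensionCount p.1 p.2) - levelRate R * R ^ (j + 1)| ≤ e j * R ^ (j + 1) := by
  obtain ⟨e, he, h⟩ := exists_tendsto_zero_of_uniform (profileStep R α) (finite_profileStep R α)
    (fun j p => Real.logb 2 (extensionCount p.1 p.2) / R ^ (j + 1) - levelRate R) (by
      intro ε hε
      have h1 := (Metric.tendsto_nhds.1 (tendsto_logb_extensionCount hR hα hαR)) ε hε
      rw [eventually_inf_principal, eventually_comap, eventually_atTop] at h1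
      obtain ⟨J, hJ⟩ := h1
      exact ⟨J, fun j hj p hp => (hJ j hj (j, p) rfl hp).le⟩)
  refine ⟨e, he, fun j p hp => ?_⟩
  have hpos : 0 < R ^ (j + 1) := by positivity
  have h2 := h j p hp
  rwa [div_sub' hpos.ne', abs_div, abs_of_pos hpos, div_le_iff₀ hpos, mul_comm (R ^ (j + 1))]
    at h2

theorem two_mul_entropyRate {R : ℝ} (hR : 2 ≤ R) :
    2 * entropyRate R = levelRate R * (R / (R - 1)) := by
  have h1 : R - 1 ≠ 0 := by linarith
  have h2 : R ≠ 0 := by linarith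
  have h3 : 2 - 2 / R = 2 * (R - 1) / R := by field_simp
  rw [entropyRate, levelRate, h3]
  field_simp
  ring

theorem sum_range_pow_succ {R : ℝ} (hR : 2 ≤ R) (n : ℕ) :
    ∑ j ∈ Finset.range n, R ^ (j + 1) = R / (R - 1) * R ^ n - R / (R - 1) := by
  have h1 : R - 1 ≠ 0 := by linarith
  rw [Finset.sum_congr rfl fun j _ => pow_succ' R j, ← Finset.mul_sum,
    geom_sum_eq (by linarith)]
  field_simp

theorem tendsto_sum_mul_pow_div_pow {R : ℝ} (hR : 2 ≤ R) {e : ℕ → ℝ}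
    (he : Tendsto e atTop (𝓝 0)) :
    Tendsto (fun n : ℕ => (∑ j ∈ Finset.range n, e j * R ^ (j + 1)) / R ^ n) atTop (𝓝 0) := by
  have hR1 : 0 < R - 1 := by linarith
  have hR0 : 0 < R := by linarith
  have h1 : (fun j => e j * R ^ (j + 1)) =o[atTop] fun j : ℕ => R ^ (j + 1) := by
    have := ((Asymptotics.isLittleO_one_iff ℝ).2 he).mul_isBigO
      (Asymptotics.isBigO_refl (fun j : ℕ => R ^ (j + 1)) atTop)
    simpa using this
  have hp := tendsto_pow_atTop_atTop_of_one_lt (by linarith : 1 < R)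
  have h2 := h1.sum_range (fun j => by positivity) (by
    simp_rw [sum_range_pow_succ hR]
    exact tendsto_atTop_add_const_right _ _ (hp.const_mul_atTop (by positivity)))
  have h3 : (fun n => ∑ j ∈ Finset.range n, R ^ (j + 1)) =O[atTop] fun n : ℕ => R ^ n := by
    refine Asymptotics.IsBigO.of_bound (R / (R - 1)) (Eventually.of_forall fun n => ?_)
    have h4 : 0 ≤ ∑ j ∈ Finset.range n, R ^ (j + 1) := Finset.sum_nonneg fun j _ => by positivity
    have h5 : 0 ≤ R / (R - 1) := by positivity
    rw [Real.norm_of_nonneg h4, Real.norm_of_nonneg (by positivity), sum_range_pow_succ hR]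
    linarith
  exact (h2.trans_isBigO h3).tendsto_div_nhds_zero

theorem IsProfile.mem_profileStep {R α : ℝ} {n : ℕ} {a : ℕ → ℕ} (ha : IsProfile R α n a) {j : ℕ}
    (hj : j < n) : (a j, a (j + 1)) ∈ profileStep R α j := by
  have hpos : ∀ i ≤ n, 1 ≤ a i := by
    intro i
    induction i with
    | zero => intro _; exact ha.zero.ge
    | succ i ih =>
      intro hi
      have := ih (by omega)
      have := ha.two_mul_le i (by omega)
      omega
  exact ⟨hpos j hj.le, ha.two_mul_le j hj, ha.abs_sub_lt j hj.le, ha.abs_sub_lt _ hj⟩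

/-- All profiles are realized by about the same number of trees, on the logarithmic scale. -/
theorem exists_abs_logb_ncard_profileSet_sub_le {R α : ℝ} (hR : 2 ≤ R) (hα : 1 < α)
    (hαR : α < R) : ∃ δ : ℕ → ℝ, Tendsto δ atTop (𝓝 0) ∧ ∀ n a, IsProfile R α n a →
      |Real.logb 2 (profileSet a n).ncard / R ^ n - 2 * entropyRate R| ≤ δ n := by
  obtain ⟨e, he, h⟩ := exists_abs_logb_extensionCount_sub_le hR hα hαR
  have hR0 : 0 < R := by linarith
  refine ⟨fun n => (∑ j ∈ Finset.range n, e j * R ^ (j + 1)) / R ^ n +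
    |2 * entropyRate R| * (1 / R) ^ n, ?_, fun n a ha => ?_⟩
  · have := (tendsto_sum_mul_pow_div_pow hR he).add ((tendsto_pow_atTop_nhds_zero_of_lt_one
      (by positivity) (by rw [div_lt_one hR0]; linarith : 1 / R < 1)).const_mul
        |2 * entropyRate R|)
    simpa using this
  · have hp : 0 < R ^ n := by positivity
    have h1 : Real.logb 2 (profileSet a n).ncard =
        ∑ j ∈ Finset.range n, Real.logb 2 (extensionCount (a j) (a (j + 1))) := by
      rw [ncard_profileSet ha.zero ha.two_mul_le, Nat.cast_prod, Real.logb_prod]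
      intro j hj
      exact_mod_cast (extensionCount_pos (ha.two_mul_le j (Finset.mem_range.1 hj))).ne'
    have h2 : |Real.logb 2 (profileSet a n).ncard -
        ∑ j ∈ Finset.range n, levelRate R * R ^ (j + 1)| ≤
          ∑ j ∈ Finset.range n, e j * R ^ (j + 1) := by
      rw [h1, ← Finset.sum_sub_distrib]
      refine (Finset.abs_sum_le_sum_abs _ _).trans (Finset.sum_le_sum fun j hj => ?_)
      have hj' := ha.mem_profileStep (Finset.mem_range.1 hj)
      generalize a (j + 1) = y at hj' ⊢
      generalize a j = x at hj' ⊢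
      exact h j (x, y) hj'
    have h3 : ∑ j ∈ Finset.range n, levelRate R * R ^ (j + 1) =
        2 * entropyRate R * R ^ n - 2 * entropyRate R := by
      rw [← Finset.mul_sum, sum_range_pow_succ hR, two_mul_entropyRate hR]; ring
    rw [h3] at h2
    rw [show Real.logb 2 (profileSet a n).ncard / R ^ n - 2 * entropyRate R =
      (Real.logb 2 (profileSet a n).ncard -
        (2 * entropyRate R * R ^ n - 2 * entropyRate R)) / R ^ n +
        (-(2 * entropyRate R)) * (1 / R) ^ n by rw [div_pow, one_pow]; field_simp; ring]
    refine (abs_add_le _ _).trans (add_le_add ?_ ?_)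
    · rw [abs_div, abs_of_pos hp]
      gcongr
    · rw [abs_mul, abs_neg, abs_of_pos (show 0 < (1 / R) ^ n by positivity)]

/-! ### The entropy rate -/

theorem entropyRate_two : entropyRate 2 = 0 := by
  norm_num [entropyRate, binaryEntropy_eq]

theorem entropyRate_four : entropyRate 4 = 1 := by
  have h : (2 : ℝ) / 4 = 2⁻¹ := by norm_num
  have h2 : Real.log 2 ≠ 0 := (Real.log_pos one_lt_two).ne'
  rw [entropyRate, binaryEntropy_eq, h, Real.binEntropy_two_inv, div_self h2]
  norm_num

theorem entropyRate_le_one {R : ℝ} (hR : 2 ≤ R) : entropyRate R ≤ 1 := by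
  have h1 : binaryEntropy (2 / R) ≤ 1 := by
    rw [binaryEntropy_eq]
    exact div_le_one_of_le₀ Real.binEntropy_le_log_two (Real.log_nonneg one_le_two)
  have h2 : 2 / R ≤ 1 := by rw [div_le_one (by linarith)]; exact hR
  have h3 : 0 ≤ (1 - binaryEntropy (2 / R)) / (2 - 2 / R) :=
    div_nonneg (by linarith) (by linarith)
  rw [entropyRate]
  linarith

theorem tendsto_entropyRate_atTop : Tendsto entropyRate atTop (𝓝 (1 / 2)) := by
  have h1 : Tendsto (fun R : ℝ => 2 / R) atTop (𝓝 0) := tendsto_const_nhds.div_atTop tendsto_id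
  have h2 := (continuous_binaryEntropy.tendsto 0).comp h1
  have h3 : binaryEntropy 0 = 0 := by simp [binaryEntropy_eq]
  rw [h3] at h2
  have := (((h2.const_sub 1).div (h1.const_sub 2) (by norm_num)).const_sub 1)
  norm_num at this
  exact this

/-! ### The limit along the realizable pairs -/

theorem isProfile_of_mem_realizablePairs {R α : ℝ} {p : ℕ × ℕ} (hp : p ∈ realizablePairs R α) :
    ∃ n a, IsProfile R α n a ∧ p = (n + 1, 2 * a n) := by
  obtain ⟨K, N⟩ := p
  obtain ⟨hK, T, hT, hN⟩ := hp
  obtain ⟨n, rfl⟩ := Nat.exists_eq_add_of_le' hK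
  refine ⟨n, _, isProfile_branchProfile hT, Prod.ext rfl ?_⟩
  rw [← numVertices_eq_branchProfile hT]
  exact hN.symm

theorem eventually_sizeToInfinity (R α : ℝ) :
    ∀ᶠ p in sizeToInfinity R α, ∃ n a, IsProfile R α n a ∧ p = (n + 1, 2 * a n) := by
  have h : ∀ᶠ p in sizeToInfinity R α, p ∈ realizablePairs R α :=
    mem_inf_of_right (mem_principal_self _)
  exact h.mono fun _ => isProfile_of_mem_realizablePairs

theorem tendsto_fst_sub_one_sizeToInfinity {R α : ℝ} (hα : 1 < α) (hαR : α < R) :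
    Tendsto (fun p : ℕ × ℕ => p.1 - 1) (sizeToInfinity R α) atTop := by
  rw [tendsto_atTop]
  intro M
  have h : ∀ᶠ p in sizeToInfinity R α, ⌈4 * R ^ M⌉₊ ≤ p.2 :=
    (tendsto_comap.mono_left inf_le_left : Tendsto Prod.snd (sizeToInfinity R α) atTop
      ).eventually_ge_atTop _
  filter_upwards [h, eventually_sizeToInfinity R α] with p h1 h2
  obtain ⟨n, a, ha, rfl⟩ := h2
  by_contra hlt
  have h3 : R ^ n ≤ R ^ M := pow_le_pow_right₀ (by linarith) (by simp at hlt; omega)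
  have h4 := ha.lt_two_mul_pow hα hαR le_rfl
  have h5 := Nat.ceil_le.1 h1
  push_cast at h5
  linarith

theorem tendsto_snd_div_pow {R α : ℝ} (hα : 1 < α) (hαR : α < R) :
    Tendsto (fun p : ℕ × ℕ => (p.2 : ℝ) / R ^ (p.1 - 1)) (sizeToInfinity R α) (𝓝 2) := by
  have := (tendsto_natCast_div_pow (x := fun p : ℕ × ℕ => p.2 / 2) hα hαR
    (tendsto_fst_sub_one_sizeToInfinity hα hαR) (by
      filter_upwards [eventually_sizeToInfinity R α] with p hp
      obtain ⟨n, a, ha, rfl⟩ := hp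
      simpa using ha.abs_sub_lt n le_rfl)).const_mul 2
  rw [mul_one] at this
  refine this.congr' ?_
  filter_upwards [eventually_sizeToInfinity R α] with p hp
  obtain ⟨n, a, ha, rfl⟩ := hp
  simp only [Nat.mul_div_cancel_left _ two_pos]
  push_cast
  ring

/-- The logarithms of the numbers of trees in `hortonSpaceOfSize` and in `hortonSpace` are
squeezed between those for two profiles, up to the number of all profiles. -/
theorem exists_logb_ncard_hortonSpace_bounds {R α : ℝ} (hR : 2 ≤ R) (hα : 1 < α) (hαR : α < R) :
    ∃ δ : ℕ → ℝ, Tendsto δ atTop (𝓝 0) ∧ ∀ n a, IsProfile R α n a →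
      2 * entropyRate R - δ n ≤
        Real.logb 2 (hortonSpaceOfSize (n + 1) R α (2 * a n)).ncard / R ^ n ∧
      Real.logb 2 (hortonSpaceOfSize (n + 1) R α (2 * a n)).ncard ≤
        Real.logb 2 (hortonSpace (n + 1) R α).ncard ∧
      Real.logb 2 (hortonSpace (n + 1) R α).ncard / R ^ n ≤ 2 * entropyRate R + δ n := by
  obtain ⟨δ, hδ, h⟩ := exists_abs_logb_ncard_profileSet_sub_le hR hα hαR
  have hR0 : 0 < R := by linarith
  have hlogR : 0 ≤ Real.logb 2 R := Real.logb_nonneg one_lt_two (by linarith)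
  -- The number of profiles is at most `(4 * R ^ n) ^ (n + 1)`.
  let η : ℕ → ℝ := fun n => (n + 1) * (2 + n * Real.logb 2 R) / R ^ n
  have hη : Tendsto η atTop (𝓝 0) := by
    have hR1 : 1 < R := by linarith
    have := (tendsto_affine_div_pow hR1 2 (2 + Real.logb 2 R)).add
      ((tendsto_pow_const_div_const_pow_of_one_lt 2 hR1).mul_const (Real.logb 2 R))
    simp only [zero_mul, add_zero] at this
    refine this.congr fun n => ?_
    simp only [η]
    ring
  have hη0 : ∀ n, 0 ≤ η n := fun n => by positivity
  refine ⟨fun n => δ n + η n, by simpa using hδ.add hη, fun n a ha => ?_⟩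
  have hp : 0 < R ^ n := by positivity
  have hfin := hortonSpace_finite hα hαR n
  have hpos := ha.ncard_pos
  have hle := ncard_profileSet_le hα hαR ha
  have hle' : (hortonSpaceOfSize (n + 1) R α (2 * a n)).ncard ≤
      (hortonSpace (n + 1) R α).ncard := Set.ncard_le_ncard (fun _ h => h.1) hfin
  refine ⟨?_, ?_, ?_⟩
  · have h1 := (abs_le.1 (h n a ha)).1
    have h2 : Real.logb 2 (profileSet a n).ncard / R ^ n ≤
        Real.logb 2 (hortonSpaceOfSize (n + 1) R α (2 * a n)).ncard / R ^ n := by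
      gcongr
      norm_num
    have := hη0 n
    linarith
  · have : 0 < (hortonSpaceOfSize (n + 1) R α (2 * a n)).ncard := hpos.trans_le hle
    gcongr
    norm_num
  · obtain ⟨b, hb, hcard⟩ := exists_isProfile_ncard_hortonSpace_le hR hα hαR n
    have h1 := (abs_le.1 (h n b hb)).2
    have hSpos : 0 < (hortonSpace (n + 1) R α).ncard := hpos.trans_le (hle.trans hle')
    have hbpos : (0 : ℝ) < (profileSet b n).ncard := by exact_mod_cast hb.ncard_pos
    have hM : (⌈2 * R ^ n⌉₊ : ℝ) ≤ 4 * R ^ n := by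
      have h2 := (Nat.ceil_lt_add_one (show 0 ≤ 2 * R ^ n by positivity)).le
      have h3 : 1 ≤ R ^ n := one_le_pow₀ (by linarith)
      linarith
    have hSle : ((hortonSpace (n + 1) R α).ncard : ℝ) ≤
        (profileSet b n).ncard * (4 * R ^ n) ^ (n + 1) := by
      calc ((hortonSpace (n + 1) R α).ncard : ℝ)
          ≤ (profileSet b n).ncard * (⌈2 * R ^ n⌉₊ : ℝ) ^ (n + 1) := by exact_mod_cast hcard
        _ ≤ _ := by gcongr
    have hlog : Real.logb 2 (hortonSpace (n + 1) R α).ncard ≤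
        Real.logb 2 (profileSet b n).ncard + (n + 1) * (2 + n * Real.logb 2 R) := by
      refine (Real.logb_le_logb_of_le one_lt_two (by exact_mod_cast hSpos) hSle).trans_eq ?_
      have h4 : Real.logb 2 4 = 2 := by
        rw [show (4 : ℝ) = 2 ^ (2 : ℕ) by norm_num, Real.logb_pow,
          Real.logb_self_eq_one one_lt_two]
        norm_num
      rw [Real.logb_mul hbpos.ne' (by positivity), Real.logb_pow,
        Real.logb_mul (by norm_num) hp.ne', Real.logb_pow, h4]
      push_cast
      ring
    have h5 : Real.logb 2 (hortonSpace (n + 1) R α).ncard / R ^ n ≤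
        Real.logb 2 (profileSet b n).ncard / R ^ n + η n := by
      rw [← add_div]
      gcongr
    linarith

/-- A quantity that lies between the two logarithms grows at the entropy rate. -/
theorem tendsto_div_snd_of_squeeze {R α : ℝ} (hR : 2 ≤ R) (hα : 1 < α) (hαR : α < R)
    {X : ℕ × ℕ → ℝ} (hX : ∀ n a, IsProfile R α n a →
      Real.logb 2 (hortonSpaceOfSize (n + 1) R α (2 * a n)).ncard ≤ X (n + 1, 2 * a n) ∧
      X (n + 1, 2 * a n) ≤ Real.logb 2 (hortonSpace (n + 1) R α).ncard) :
    Tendsto (fun p : ℕ × ℕ => X p / (p.2 : ℝ)) (sizeToInfinity R α) (𝓝 (entropyRate R)) := by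
  obtain ⟨δ, hδ, h⟩ := exists_logb_ncard_hortonSpace_bounds hR hα hαR
  have hR0 : 0 < R := by linarith
  have hδ' := hδ.comp (tendsto_fst_sub_one_sizeToInfinity hα hαR)
  have h1 : Tendsto (fun p : ℕ × ℕ => X p / R ^ (p.1 - 1)) (sizeToInfinity R α)
      (𝓝 (2 * entropyRate R)) := by
    refine tendsto_of_tendsto_of_tendsto_of_le_of_le'
      (by simpa using hδ'.const_sub (2 * entropyRate R))
      (by simpa using hδ'.const_add (2 * entropyRate R)) ?_ ?_
    · filter_upwards [eventually_sizeToInfinity R α] with p hp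
      obtain ⟨n, a, ha, rfl⟩ := hp
      have hp : 0 < R ^ n := by positivity
      refine (h n a ha).1.trans ?_
      simp only [Nat.add_sub_cancel]
      gcongr
      exact (hX n a ha).1
    · filter_upwards [eventually_sizeToInfinity R α] with p hp
      obtain ⟨n, a, ha, rfl⟩ := hp
      have hp : 0 < R ^ n := by positivity
      refine le_trans ?_ (h n a ha).2.2
      simp only [Nat.add_sub_cancel]
      gcongr
      exact (hX n a ha).2
  have h2 := h1.div (tendsto_snd_div_pow hα hαR) two_ne_zero
  rw [mul_div_cancel_left₀ _ two_ne_zero] at h2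
  refine h2.congr fun p => ?_
  have hp : R ^ (p.1 - 1) ≠ 0 := by positivity
  simp only [Pi.div_apply]
  exact div_div_div_cancel_right₀ hp _ _

end Horton

open Horton in
theorem mainTheorem1 :
    (∀ R α : ℝ, 2 ≤ R → 1 < α → α < R →
      (∀ K : ℕ, 1 ≤ K →
        (hortonSpace K R α).Finite ∧ (hortonSpace K R α).Nonempty ∧
        shannonEntropy (uniformMass (hortonSpace K R α)) =
          Real.logb 2 ((hortonSpace K R α).ncard : ℝ)) ∧
      (∀ M : ℕ, ∀ᶠ K : ℕ in atTop, ∀ T ∈ hortonSpace K R α, M ≤ T.numVertices) ∧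
      Tendsto
        (fun p : ℕ × ℕ => shannonEntropy (uniformMass (hortonSpace p.1 R α)) / (p.2 : ℝ))
        (sizeToInfinity R α) (𝓝 (entropyRate R)) ∧
      Tendsto
        (fun p : ℕ × ℕ =>
          shannonEntropy (uniformMass (hortonSpaceOfSize p.1 R α p.2)) / (p.2 : ℝ))
        (sizeToInfinity R α) (𝓝 (entropyRate R))) ∧
    entropyRate 2 = 0 ∧
    entropyRate 4 = 1 ∧
    IsMaxOn entropyRate (Set.Ici 2) 4 ∧
    Tendsto entropyRate atTop (𝓝 (1 / 2)) := by
  refine ⟨fun R α hR hα hαR => ?_, entropyRate_two, entropyRate_four, fun R hR => ?_,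
    tendsto_entropyRate_atTop⟩
  · have hentropy : ∀ n, shannonEntropy (uniformMass (hortonSpace (n + 1) R α)) =
        Real.logb 2 ((hortonSpace (n + 1) R α).ncard : ℝ) := fun n =>
      shannonEntropy_uniformMass (hortonSpace_finite hα hαR n) (hortonSpace_nonempty hR hα n)
    have hentropySize : ∀ n a, IsProfile R α n a →
        shannonEntropy (uniformMass (hortonSpaceOfSize (n + 1) R α (2 * a n))) =
          Real.logb 2 ((hortonSpaceOfSize (n + 1) R α (2 * a n)).ncard : ℝ) := fun n a ha =>
      shannonEntropy_uniformMass ((hortonSpace_finite hα hαR n).subset fun _ h => h.1)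
        (Set.nonempty_of_ncard_ne_zero
          (ha.ncard_pos.trans_le (ncard_profileSet_le hα hαR ha)).ne')
    obtain ⟨_, -, hbounds⟩ := exists_logb_ncard_hortonSpace_bounds hR hα hαR
    refine ⟨fun K hK => ?_, fun M => ?_, ?_, ?_⟩
    · obtain ⟨n, rfl⟩ := Nat.exists_eq_add_of_le' hK
      exact ⟨hortonSpace_finite hα hαR n, hortonSpace_nonempty hR hα n, hentropy n⟩
    · filter_upwards [eventually_ge_atTop M] with K hK T hT
      exact hK.trans (le_numVertices_of_mem_hortonSpace hT)
    · refine tendsto_div_snd_of_squeeze hR hα hαR fun n a ha => ?_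
      simp only [hentropy]
      exact ⟨(hbounds n a ha).2.1, le_rfl⟩
    · refine tendsto_div_snd_of_squeeze hR hα hαR fun n a ha => ?_
      simp only [hentropySize n a ha]
      exact ⟨le_rfl, (hbounds n a ha).2.1⟩
  · change entropyRate R ≤ entropyRate 4
    rw [entropyRate_four]
    exact entropyRate_le_one hR
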